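/- **Definitions.** All graphs are finite and simple. For a graph $G=(V,E)$ and $k\ge 1$, we say that at least a fraction $\xi$ of the edges of $G$ cannot be $k$-colored if every map $\chi:V\to\{0,\dots,k-1\}$ satisfies $|\{\{u,v\}\in E:\chi(u)=\chi(v)\}|/|E|\ge\xi$ (the quotient is read as $0$ if $E=\emptyset$). Let $|\psi_0\rangle=|0\rangle$ and $|\psi_j\rangle=\frac1{\sqrt3}|0\rangle+e^{2\pi i(j-1)/3}\sqrt{\tfrac23}\,|1\rangle$ for $j=1,2,3$ be the vectors of the tetrahedral qubit SIC-POVM, $F_a=\frac12|\psi_a\rangle\langle\psi_a|$ its elements, and $D_a=3|\psi_a\rangle\langle\psi_a|-\mathbb 1$ the dual basis. For $\alpha\in\{0,1,2,3\}^V$ put $F_\alpha=\bigotimes_{v\in V}F_{\alpha_v}$ and $D_\alpha=\bigotimes_{v\in V}D_{\alpha_v}$, operators on one qubit per vertex. For an operator $X$ and $I\subseteq V$, let $X^{(I)}=\mathrm{Tr}_{V\setminus I}X$. An operator $X$ is a *2-local quasi-quantum state* if $\mathrm{Tr}\,X=1$, $X=X^\dagger$, $\mathrm{Tr}(F_\alpha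 X)\ge0$ for every $\alpha$, and $X^{(I)}\succeq0$ for every $I$ with $|I|=2$. For $\lambda\in(0,1/4)$, a *$\lambda$-solution* of $G=(V,E)$ is an operator $X=\sum_\alpha\mu(\alpha)D_\alpha$, with $\mu$ a probability distribution on $\{0,1,2,3\}^V$, such that (1) $X$ is a 2-local quasi-quantum state; (2) every $\alpha$ with $\mu(\alpha)>0$ is a legal 4-coloring of $G$; (3) $\mu(\pi\circ\alpha)=\mu(\alpha)$ for every $\alpha$ and every permutation $\pi$ of the four colors; (4) $X^{(ij)}\succeq\lambda\mathbb 1$ for all $i\ne j$ with $\{i,j\}\notin E$. A *$(3,\lambda)$-decomposable graph* is a graph $G=(V,E)$ given together with a decomposition of $E$ into three pairwise disjoint subsets, $E=E_1\cup E_2\cup E_3$, such that each of the graphs $(V,E_1),(V,E_2),(V,E_3)$ has a $\lambda$-solution. **Lemma.** There are constants $\lambda\in(0,1/4)$ and $c>0$ and a polynomial-time computable map that takes any graph $G'=(V',E')$ of maximal degree at most $4$ to a graph $G=(V,E)$ together with a decomposition $E=E_1\cup E_2\cup E_3$ into pairwise disjoint subsets, such that: 1. $G$, with this decomposition, is $(3,\lambda)$-decomposable;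 2. if $G'$ is $3$-colorable, then $G$ is $4$-colorable; 3. for every $\xi'$, if at least a fraction $\xi'$ of the edges of $G'$ cannot be $3$-colored, then at least a fraction $\xi=c\,\xi'$ of the edges of $G$ cannot be $4$-colored. Here graphs have vertex sets $\{0,\dots,n-1\}$ and are encoded by their order and adjacency matrix, in which, for the output, the edges of $E_1,E_2,E_3$ are marked $1,2,3$. -/

import Mathlib

open scoped ComplexOrder

/-! ### Graphs, colourings and violated edges -/

/-- The edges of `G` both of whose endpoints receive the same colour under `χ`. -/
def violatedEdges {V C : Type} (G : SimpleGraph V) (χ : V → C) : Set (Sym2 V) :=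
  {e ∈ G.edgeSet | (e.map χ).IsDiag}

/-- At least a fraction `ξ` of the edges of `G` cannot be legally `k`-coloured: every assignment
of `k` colours to the vertices violates at least a fraction `ξ` of the edges.  For a graph without
edges the violated fraction is `0 / 0 = 0`, in accordance with its being colourable. -/
def FractionUncolorable {V : Type} (k : ℕ) (G : SimpleGraph V) (ξ : ℝ) : Prop :=
  ∀ χ : V → Fin k, ξ ≤ ((violatedEdges G χ).ncard : ℝ) / (G.edgeSet.ncard : ℝ)

/-- A finite simple graph on the vertex set `{0, …, order - 1}`. -/
structure FiniteGraph where
  order : ℕ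
  graph : SimpleGraph (Fin order)

/-- Every vertex has at most `d` neighbours. -/
def FiniteGraph.MaxDegreeLE (G : FiniteGraph) (d : ℕ) : Prop :=
  ∀ v, (G.graph.neighborSet v).ncard ≤ d

/-- A finite simple graph given together with a decomposition of its edges into three pairwise
disjoint subsets; `part ℓ` is the subgraph, on all the vertices, formed by the `ℓ`-th subset. -/
structure PartitionedGraph extends FiniteGraph where
  part : Fin 3 → SimpleGraph (Fin order)
  edges_eq : graph.edgeSet = ⋃ l, (part l).edgeSet
  edges_disjoint : ∀ l l', l ≠ l' → Disjoint (part l).edgeSet (part l').edgeSet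

/-! ### The qubit SIC-POVM, its dual basis, and quasi-quantum states -/

noncomputable section

/-- The four tetrahedral vectors `ψ₀, ψ₁, ψ₂, ψ₃` of the qubit SIC-POVM. -/
def sicVec : Fin 4 → Fin 2 → ℂ :=
  ![![1, 0],
    ![((1 / Real.sqrt 3 : ℝ) : ℂ), ((Real.sqrt (2 / 3) : ℝ) : ℂ)],
    ![((1 / Real.sqrt 3 : ℝ) : ℂ),
      Complex.exp (Complex.I * (2 * Real.pi / 3)) * ((Real.sqrt (2 / 3) : ℝ) : ℂ)],
    ![((1 / Real.sqrt 3 : ℝ) : ℂ),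
      Complex.exp (Complex.I * (4 * Real.pi / 3)) * ((Real.sqrt (2 / 3) : ℝ) : ℂ)]]

/-- The projector `|ψ_a⟩⟨ψ_a|`. -/
def sicProj (a : Fin 4) : Matrix (Fin 2) (Fin 2) ℂ :=
  Matrix.of fun x y => sicVec a x * star (sicVec a y)

/-- The POVM element `F_a = ½ |ψ_a⟩⟨ψ_a|`. -/
def povmF (a : Fin 4) : Matrix (Fin 2) (Fin 2) ℂ := (1 / 2 : ℂ) • sicProj a

/-- The dual basis element `D_a = 3 |ψ_a⟩⟨ψ_a| - 1`. -/
def dualD (a : Fin 4) : Matrix (Fin 2) (Fin 2) ℂ := (3 : ℂ) • sicProj a - 1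

/-- Operators on a register with one qubit per element of `V`. -/
abbrev QubitOp (V : Type) := Matrix (V → Fin 2) (V → Fin 2) ℂ

/-- The tensor product `⨂ v, A v` of one-qubit operators. -/
def tensorOp {V : Type} [Fintype V] (A : V → Matrix (Fin 2) (Fin 2) ℂ) : QubitOp V :=
  Matrix.of fun x y => ∏ v, A v (x v) (y v)

/-- The basis string that is `x` on `I` and `z` off `I`. -/
def glue {V : Type} [DecidableEq V] (I : Finset V) (x : {v // v ∈ I} → Fin 2)
    (z : {v // v ∉ I} → Fin 2) : V → Fin 2 :=
  fun v => if h : v ∈ I then x ⟨v, h⟩ else z ⟨v, h⟩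

/-- The marginal of `X` on the qubits in `I`: all the other qubits are traced out. -/
def marginal {V : Type} [Fintype V] [DecidableEq V] (I : Finset V) (X : QubitOp V) :
    QubitOp {v // v ∈ I} :=
  Matrix.of fun x y => ∑ z : {v // v ∉ I} → Fin 2, X (glue I x z) (glue I y z)

/-- `k`-local quasi-quantum states of qubits (with respect to the SIC-POVM above).  The order on
`ℂ` is the one in which `0 ≤ z` says that `z` is real and nonnegative. -/
structure IsQQState {V : Type} [Fintype V] [DecidableEq V] (k : ℕ) (X : QubitOp V) : Prop where
  trace_eq_one : X.trace = 1
  hermitian : X.IsHermitian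
  global_pos : ∀ a : V → Fin 4, 0 ≤ (tensorOp (fun v => povmF (a v)) * X).trace
  local_pos : ∀ I : Finset V, I.card = k → (marginal I X).PosSemidef

/-- The operator `X(μ) = ∑ₐ μ(a) Dₐ`, where `Dₐ = ⨂ v, D_{a v}`. -/
def opOf {V : Type} [Fintype V] [DecidableEq V] (μ : (V → Fin 4) → ℝ) : QubitOp V :=
  ∑ a : V → Fin 4, (μ a : ℂ) • tensorOp (fun v => dualD (a v))

/-- The operator `X(μ)` of the probability distribution `μ` is a `lam`-solution of `G`. -/
structure IsLambdaSolution {V : Type} [Fintype V] [DecidableEq V] (lam : ℝ) (G : SimpleGraph V)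
    (μ : (V → Fin 4) → ℝ) : Prop where
  nonneg : ∀ a, 0 ≤ μ a
  sum_eq_one : ∑ a, μ a = 1
  qqState : IsQQState 2 (opOf μ)
  legal : ∀ a, 0 < μ a → ∀ u v, G.Adj u v → a u ≠ a v
  colorInvariant : ∀ (π : Equiv.Perm (Fin 4)) (a : V → Fin 4), μ (fun v => π (a v)) = μ a
  marginal_ge : ∀ i j, i ≠ j → ¬ G.Adj i j →
    (marginal {i, j} (opOf μ) - (lam : ℂ) • (1 : QubitOp _)).PosSemidef

/-- Together with its given decomposition, the graph is `(3, lam)`-decomposable. -/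
def PartitionedGraph.IsDecomposable (lam : ℝ) (G : PartitionedGraph) : Prop :=
  ∀ l, ∃ μ : (Fin G.order → Fin 4) → ℝ, IsLambdaSolution lam (G.part l) μ

end

/-! ### Polynomial time

The machine is the unit-cost random access machine with addition and truncated subtraction (no
multiplication), for which polynomial time is the same as for Turing machines: `t` steps lengthen
the numbers occurring by at most `t` bits.  Its control is written with `if` and `while`. -/

/-- The configuration of a random access machine: finitely many registers are named by a program,
the memory is addressed indirectly through registers, and the output is a write-only list. -/
structure RamState where
  reg : ℕ → ℕ
  mem : ℕ → ℕ
  out : List ℕ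

/-- Programs of the random access machine. -/
inductive RamProg where
  /-- `reg r := c` -/
  | const (r c : ℕ)
  /-- `reg r := reg s + reg t` -/
  | add (r s t : ℕ)
  /-- `reg r := reg s - reg t`, or `0` if that is negative -/
  | sub (r s t : ℕ)
  /-- `reg r := mem (reg s)` -/
  | load (r s : ℕ)
  /-- `mem (reg r) := reg s` -/
  | store (r s : ℕ)
  /-- append `reg r` to the output -/
  | print (r : ℕ)
  /-- first `p`, then `q` -/
  | seq (p q : RamProg)
  /-- `p` if `reg r ≠ 0`, otherwise `q` -/
  | ite (r : ℕ) (p q : RamProg)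
  /-- repeat `p` as long as `reg r ≠ 0` -/
  | loop (r : ℕ) (p : RamProg)

/-- `RamRuns p s s' t`: started in `s`, the program `p` halts in `s'` after exactly `t` steps; each
elementary instruction and each test of a condition is one step. -/
inductive RamRuns : RamProg → RamState → RamState → ℕ → Prop where
  | const (r c : ℕ) (s : RamState) :
      RamRuns (.const r c) s { s with reg := Function.update s.reg r c } 1
  | add (r i j : ℕ) (s : RamState) :
      RamRuns (.add r i j) s { s with reg := Function.update s.reg r (s.reg i + s.reg j) } 1
  | sub (r i j : ℕ) (s : RamState) :
      RamRuns (.sub r i j) s { s with reg := Function.update s.reg r (s.reg i - s.reg j) } 1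
  | load (r i : ℕ) (s : RamState) :
      RamRuns (.load r i) s { s with reg := Function.update s.reg r (s.mem (s.reg i)) } 1
  | store (r i : ℕ) (s : RamState) :
      RamRuns (.store r i) s { s with mem := Function.update s.mem (s.reg r) (s.reg i) } 1
  | print (r : ℕ) (s : RamState) :
      RamRuns (.print r) s { s with out := s.out ++ [s.reg r] } 1
  | seq {p q : RamProg} {s s' s'' : RamState} {t t' : ℕ} :
      RamRuns p s s' t → RamRuns q s' s'' t' → RamRuns (.seq p q) s s'' (t + t')
  | ite_pos {r : ℕ} {p q : RamProg} {s s' : RamState} {t : ℕ} :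
      s.reg r ≠ 0 → RamRuns p s s' t → RamRuns (.ite r p q) s s' (t + 1)
  | ite_neg {r : ℕ} {p q : RamProg} {s s' : RamState} {t : ℕ} :
      s.reg r = 0 → RamRuns q s s' t → RamRuns (.ite r p q) s s' (t + 1)
  | loop_stop {r : ℕ} {p : RamProg} {s : RamState} :
      s.reg r = 0 → RamRuns (.loop r p) s s 1
  | loop_step {r : ℕ} {p : RamProg} {s s' s'' : RamState} {t t' : ℕ} :
      s.reg r ≠ 0 → RamRuns p s s' t → RamRuns (.loop r p) s' s'' t' →
        RamRuns (.loop r p) s s'' (t + t' + 1)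

/-- The input occupies the first memory cells, its length is in register `0`; all the rest is `0`
and the output is empty. -/
def RamState.init (w : List ℕ) : RamState where
  reg := Function.update (fun _ => 0) 0 w.length
  mem := fun i => w.getD i 0
  out := []

/-- The size of an input: the total binary length of its entries, each with a separator. -/
def inputSize (w : List ℕ) : ℕ := (w.map fun x => x.size + 1).sum

/-- `f` is computable in polynomial time with respect to the given encodings. -/
def PolyTimeComputable {α β : Type} (encIn : α → List ℕ) (encOut : β → List ℕ) (f : α → β) :
    Prop :=
  ∃ (P : RamProg) (p : Polynomial ℕ), ∀ a, ∃ (s : RamState) (t : ℕ),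
    RamRuns P (RamState.init (encIn a)) s t ∧ t ≤ p.eval (inputSize (encIn a)) ∧
      s.out = encOut (f a)

/-- The number `n`, followed by the entries of an `n × n` matrix, row by row. -/
def encodeMatrix (n : ℕ) (M : Fin n → Fin n → ℕ) : List ℕ :=
  n :: (List.finRange n).flatMap fun i => (List.finRange n).map fun j => M i j

open Classical in
/-- A graph is encoded by its adjacency matrix. -/
noncomputable def FiniteGraph.encode (G : FiniteGraph) : List ℕ :=
  encodeMatrix G.order fun i j => if G.graph.Adj i j then 1 else 0

open Classical in
/-- A graph with a decomposition of its edges is encoded by its adjacency matrix, in which the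
edges of the first, second and third subset are marked `1`, `2` and `3`. -/
noncomputable def PartitionedGraph.encode (G : PartitionedGraph) : List ℕ :=
  encodeMatrix G.order fun i j =>
    if (G.part 0).Adj i j then 1 else if (G.part 1).Adj i j then 2
      else if (G.part 2).Adj i j then 3 else 0

/-! For a colour-invariant distribution, the joint law of the colours of two vertices depends only
on the probability p that they agree. Since the SIC-POVM is a 2-design, the two-qubit marginal has
eigenvalue p on the triplet space and 1 - 3p on the singlet (`marginal_opOf`). So a colour-invariant
distribution on legal colourings is a λ-solution once λ ≤ p ≤ (1 - λ)/3 for all non-adjacent pairs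
(`isLambdaSolution_of_equalProb`). Permuting the colours independently in separate blocks of a graph
gives p = 1/4 across blocks, so only single blocks matter (`isLambdaSolution_blockDist`). In a K₄
there is nothing to check. In a star with at most 16 leaves, the leaves take the values of a random
non-zero linear form on 𝔽₃³ at distinct points, shifted away from the colour of the hub; two leaves
agree with probability 8/26 = 4/13 < 1/3, whence λ = 1/13.

The reduction gives every vertex u a reference hub z_u (slot 8 of (u,u)) and a colour hub x_u (slot
9), and every ordered pair (u,v) of neighbours two copies of K₄, on the slots 0-3 and 4-7. Both z_u
and z_v are joined to 1, 2, 3, so in a legal colouring both copy slot 0. Slots 5, 6, 7 force x_u to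
copy slot 4, slots 4, 6, 7 force x_v to copy slot 5, and both avoid slot 0. Thus z_u = z_v, x_u ≠
x_v, and x uses only the three other colours; conversely, a 3-colouring extends
(`gadgetGraph_colorable`). The three parts are the K₄'s, the edges to the hubs of u, and the edges
to the hubs of v. The last two are unions of stars, with at most 4 · 4 leaves by the degree bound.

For the gap, an arbitrary 4-colouring is decoded locally by reading x_u relative to z_u. An edge uv
violated by the decoded colouring forces a violated edge in the block of (u,v) (`exists_violated`);
distinct edges use distinct blocks, and there are at most 600 edges per edge of the given graph, so
c = 1/600.

An entry of the output depends only on slots, on equality of positions and on one table lookup, so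
nested loops print the matrix. -/

/-! ### Tensor products and their marginals -/

section Tensor

variable {V : Type} [Fintype V]

theorem tensorOp_mul [DecidableEq V] (A B : V → Matrix (Fin 2) (Fin 2) ℂ) :
    tensorOp A * tensorOp B = tensorOp fun v => A v * B v := by
  ext x y
  simp only [tensorOp, Matrix.mul_apply, Matrix.of_apply, ← Finset.prod_mul_distrib]
  exact (Fintype.prod_sum fun v z => A v (x v) z * B v z (y v)).symm

theorem trace_tensorOp [DecidableEq V] (A : V → Matrix (Fin 2) (Fin 2) ℂ) :
    (tensorOp A).trace = ∏ v, (A v).trace := by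
  simp only [tensorOp, Matrix.trace, Matrix.diag, Matrix.of_apply]
  exact (Fintype.prod_sum fun v z => A v z z).symm

theorem tensorOp_isHermitian {A : V → Matrix (Fin 2) (Fin 2) ℂ} (h : ∀ v, (A v).IsHermitian) :
    (tensorOp A).IsHermitian := by
  ext x y
  simp only [tensorOp, Matrix.conjTranspose_apply, Matrix.of_apply, star_prod]
  exact Finset.prod_congr rfl fun v _ => (h v).apply _ _

theorem marginal_tensorOp [DecidableEq V] (I : Finset V) (A : V → Matrix (Fin 2) (Fin 2) ℂ)
    (h : ∀ v ∉ I, (A v).trace = 1) :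
    marginal I (tensorOp A) = tensorOp fun v : {v // v ∈ I} => A v := by
  ext x y
  have key : ∀ z : {v // v ∉ I} → Fin 2,
      ∏ v, A v (glue I x z v) (glue I y z v) =
        (∏ v : {v // v ∈ I}, A v (x v) (y v)) * ∏ v : {v // v ∉ I}, A v (z v) (z v) := by
    intro z
    rw [← Fintype.prod_subtype_mul_prod_subtype (fun v => v ∈ I)]
    congr 1
    · exact Finset.prod_congr (by ext; simp) fun v _ => by simp [glue, v.2]
    · exact Finset.prod_congr (by ext; simp) fun v _ => by simp [glue, v.2]
  simp only [marginal, tensorOp, Matrix.of_apply, key, ← Finset.mul_sum]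
  have hone : ∏ v : {v // v ∉ I}, ∑ z, A v z z = 1 := Finset.prod_eq_one fun v _ => h v v.2
  rw [← Fintype.prod_sum fun (v : {v // v ∉ I}) z => A v z z, hone, mul_one]

theorem marginal_sum_smul [DecidableEq V] (I : Finset V) {ι : Type} [Fintype ι] (r : ι → ℂ)
    (X : ι → QubitOp V) :
    marginal I (∑ i, r i • X i) = ∑ i, r i • marginal I (X i) := by
  ext x y
  simp only [marginal, Matrix.of_apply, Matrix.sum_apply, Matrix.smul_apply, smul_eq_mul,
    Finset.mul_sum]
  exact Finset.sum_comm

end Tensor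

/-! ### The dual basis -/

section Dual

open Complex

/-- The primitive third root of unity occurring in the SIC-POVM. -/
noncomputable def sicRoot : ℂ := exp (I * (2 * Real.pi / 3))

theorem exp_four_pi_div_three : exp (I * (4 * Real.pi / 3)) = sicRoot ^ 2 := by
  rw [sicRoot, ← exp_nat_mul]
  congr 1
  push_cast
  ring

theorem sicRoot_cube : sicRoot ^ 3 = 1 := by
  rw [sicRoot, ← exp_nat_mul, ← exp_two_pi_mul_I]
  congr 1
  push_cast
  ring

theorem conj_sicRoot : (starRingEnd ℂ) sicRoot = sicRoot ^ 2 := by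
  have h : (starRingEnd ℂ) sicRoot * sicRoot = 1 := by
    have hI : I * (2 * Real.pi / 3) = ((2 * Real.pi / 3 : ℝ) : ℂ) * I := by
      push_cast
      ring
    rw [sicRoot, hI, ← exp_conj, ← exp_add, map_mul, conj_ofReal, conj_I]
    simp
  have h0 : sicRoot ≠ 0 := exp_ne_zero _
  apply mul_right_cancel₀ h0
  rw [h, ← sicRoot_cube]
  ring

theorem sicRoot_sum : sicRoot ^ 2 + sicRoot + 1 = 0 := by
  have h1 : sicRoot - 1 ≠ 0 := by
    intro h
    have him : sicRoot.im = Real.sin (2 * Real.pi / 3) := by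
      have : I * (2 * Real.pi / 3) = ((2 * Real.pi / 3 : ℝ) : ℂ) * I := by
        push_cast
        ring
      rw [sicRoot, this, exp_ofReal_mul_I_im]
    have hpos : 0 < Real.sin (2 * Real.pi / 3) :=
      Real.sin_pos_of_pos_of_lt_pi (by positivity) (by linarith [Real.pi_pos])
    rw [sub_eq_zero.mp h] at him
    simp at him
    linarith
  apply mul_left_cancel₀ h1
  linear_combination sicRoot_cube

theorem sqrt_third_mul_self : ((1 / Real.sqrt 3 : ℝ) : ℂ) * ((1 / Real.sqrt 3 : ℝ) : ℂ) = 1 / 3 := by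
  rw [← ofReal_mul, div_mul_div_comm, Real.mul_self_sqrt (by norm_num)]
  norm_num

theorem sqrt_two_thirds_mul_self :
    ((Real.sqrt (2 / 3) : ℝ) : ℂ) * ((Real.sqrt (2 / 3) : ℝ) : ℂ) = 2 / 3 := by
  rw [← ofReal_mul, Real.mul_self_sqrt (by norm_num)]
  norm_num

/-- The length of the off-diagonal entries of the dual basis. -/
noncomputable def dualOff : ℂ := 3 * (((1 / Real.sqrt 3 : ℝ) : ℂ) * ((Real.sqrt (2 / 3) : ℝ) : ℂ))

theorem dualOff_sq : dualOff ^ 2 = 2 := by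
  have h1 := sqrt_third_mul_self
  have h2 := sqrt_two_thirds_mul_self
  simp only [dualOff]
  set a := ((1 / Real.sqrt 3 : ℝ) : ℂ)
  set b := ((Real.sqrt (2 / 3) : ℝ) : ℂ)
  linear_combination (9 * b * b) * h1 + 3 * h2

theorem dualD_eq :
    dualD = ![!![2, 0; 0, -1], !![0, dualOff; dualOff, 1],
      !![0, dualOff * sicRoot ^ 2; dualOff * sicRoot, 1],
      !![0, dualOff * sicRoot; dualOff * sicRoot ^ 2, 1]] := by
  have h1 := sqrt_third_mul_self
  have h2 := sqrt_two_thirds_mul_self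
  have h3 := sicRoot_cube
  funext a
  ext x y
  have hr : exp (I * (2 * Real.pi / 3)) = sicRoot := rfl
  simp only [dualD, sicProj, sicVec, exp_four_pi_div_three, hr, dualOff]
  generalize ha : ((1 / Real.sqrt 3 : ℝ) : ℂ) = s at *
  generalize hb : ((Real.sqrt (2 / 3) : ℝ) : ℂ) = t at *
  have hs : (starRingEnd ℂ) s = s := by rw [← ha, conj_ofReal]
  have ht : (starRingEnd ℂ) t = t := by rw [← hb, conj_ofReal]
  fin_cases a <;> fin_cases x <;> fin_cases y <;>
    simp [hs, ht, conj_sicRoot] <;> first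
      | ring1
      | linear_combination 3 * h1
      | linear_combination 3 * h2
      | linear_combination 3 * h2 + 3 * t * t * h3
      | linear_combination 3 * h2 + 3 * t * t * (sicRoot ^ 3 + 1) * h3
      | linear_combination 3 * s * t * sicRoot * h3

theorem povmF_eq (a : Fin 4) : povmF a = (1 / 6 : ℂ) • (dualD a + 1) := by
  rw [povmF, dualD, sub_add_cancel, smul_smul]
  norm_num

theorem dualD_isHermitian (a : Fin 4) : (dualD a).IsHermitian := by
  have : (sicProj a).IsHermitian := by
    ext x y
    simp [sicProj, mul_comm]
  unfold dualD
  refine Matrix.IsHermitian.sub ?_ Matrix.isHermitian_one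
  ext x y
  have h := this.apply x y
  simp only [Matrix.conjTranspose_apply, Matrix.smul_apply, smul_eq_mul, star_mul', h]
  simp

theorem trace_dualD (a : Fin 4) : (dualD a).trace = 1 := by
  rw [dualD_eq]
  fin_cases a <;> (simp [Matrix.trace_fin_two]; try norm_num)

/-- Distinct SIC vectors have squared overlap 1/3, and (3 · 1/3 - 1)/2 = 0. -/
theorem trace_povmF_mul_dualD (a b : Fin 4) :
    (povmF a * dualD b).trace = if a = b then 1 else 0 := by
  have h1 := dualOff_sq
  have h2 := sicRoot_sum
  have h3 := sicRoot_cube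
  rw [povmF_eq, dualD_eq]
  fin_cases a <;> fin_cases b <;>
    simp [Matrix.trace_fin_two, Matrix.mul_apply, Fin.sum_univ_two, Matrix.add_apply] <;> first
      | ring1
      | linear_combination (1 / 3) * h1
      | linear_combination (1 / 3) * h1 + (1 / 3) * dualOff ^ 2 * h3
      | linear_combination (1 / 6) * dualOff ^ 2 * h2 - (1 / 6) * h1
      | linear_combination (1 / 6) * dualOff ^ 2 * h2 + (1 / 6) * dualOff ^ 2 * sicRoot * h3 - (1 / 6) * h1

theorem sum_dualD (x y : Fin 2) : ∑ a, dualD a x y = if x = y then 2 else 0 := by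
  have h2 := sicRoot_sum
  rw [dualD_eq]
  fin_cases x <;> fin_cases y <;> simp [Fin.sum_univ_four] <;> first
    | linear_combination dualOff * h2
    | norm_num

/-- Twice the matrix entries of the projector onto the singlet state. -/
def singletEntry (x x' y y' : Fin 2) : ℂ :=
  (![![0, 1], ![-1, 0]] x x') * (![![0, 1], ![-1, 0]] y y')

/-- This is the 2-design property: the projectors onto ψ_a ⊗ ψ_a sum to 4/3 times the symmetric
projector, so the sum of D_a ⊗ D_a is 4 on the triplet space and -8 on the singlet. -/
theorem sum_dualD_mul_dualD (x x' y y' : Fin 2) :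
    ∑ a, dualD a x y * dualD a x' y' =
      (if x = y ∧ x' = y' then 4 else 0) - 6 * singletEntry x x' y y' := by
  have h1 := dualOff_sq
  have h2 := sicRoot_sum
  have h3 := sicRoot_cube
  rw [dualD_eq]
  fin_cases x <;> fin_cases y <;> fin_cases x' <;> fin_cases y' <;>
    simp [Fin.sum_univ_four, singletEntry] <;> first
    | linear_combination dualOff * h2
    | linear_combination dualOff ^ 2 * h2 + dualOff ^ 2 * sicRoot * h3
    | linear_combination 3 * h1 + 2 * dualOff ^ 2 * h3
    | norm_num

end Dual

/-! ### Two-qubit marginals of colour-invariant distributions -/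

section PairMarginal

variable {V : Type} [Fintype V] [DecidableEq V]

/-- The probability that `i` and `j` receive the same colour. -/
noncomputable def equalProb (μ : (V → Fin 4) → ℝ) (i j : V) : ℝ :=
  ∑ a : V → Fin 4, if a i = a j then μ a else 0

/-- The probability that `i` and `j` receive the colours `b` and `c`. -/
noncomputable def pairProb (μ : (V → Fin 4) → ℝ) (i j : V) (b c : Fin 4) : ℝ :=
  ∑ a : V → Fin 4, if a i = b ∧ a j = c then μ a else 0

theorem pairProb_perm {μ : (V → Fin 4) → ℝ}
    (h : ∀ (π : Equiv.Perm (Fin 4)) (a : V → Fin 4), μ (fun v => π (a v)) = μ a)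
    (π : Equiv.Perm (Fin 4)) (i j : V) (b c : Fin 4) :
    pairProb μ i j (π b) (π c) = pairProb μ i j b c := by
  unfold pairProb
  rw [← (Equiv.piCongrRight fun _ : V => π).sum_comp]
  refine Finset.sum_congr rfl fun a _ => ?_
  have := h π a
  simp only [Equiv.piCongrRight_apply, Pi.map_apply, EmbeddingLike.apply_eq_iff_eq]
  rw [← this]
  rfl

theorem sum_mul_pair (μ : (V → Fin 4) → ℝ) (i j : V) (g : Fin 4 → Fin 4 → ℂ) :
    ∑ a, (μ a : ℂ) * g (a i) (a j) = ∑ b, ∑ c, (pairProb μ i j b c : ℂ) * g b c := by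
  have h : ∀ a : V → Fin 4, (μ a : ℂ) * g (a i) (a j) =
      ∑ b, ∑ c, ((if a i = b ∧ a j = c then μ a else 0 : ℝ) : ℂ) * g b c := by
    intro a
    rw [Finset.sum_eq_single (a i), Finset.sum_eq_single (a j)]
    · simp
    · intro c _ hc
      simp [hc.symm]
    · simp
    · intro b _ hb
      simp [hb.symm]
    · simp
  simp only [h, pairProb, Complex.ofReal_sum, Finset.sum_mul]
  rw [Finset.sum_comm]
  refine Finset.sum_congr rfl fun b _ => ?_
  rw [Finset.sum_comm]

theorem exists_perm_pair (b c : Fin 4) (h : b ≠ c) : ∃ π : Equiv.Perm (Fin 4), π 0 = b ∧ π 1 = c := by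
  by_cases hb : b = 1
  · subst hb
    refine ⟨(Equiv.swap 0 1).trans (Equiv.swap 0 c), ?_, ?_⟩
    · rw [Equiv.trans_apply, Equiv.swap_apply_left, Equiv.swap_apply_of_ne_of_ne (by decide) h]
    · simp
  · refine ⟨(Equiv.swap 0 b).trans (Equiv.swap 1 c), ?_, ?_⟩
    · simp [Equiv.swap_apply_of_ne_of_ne hb h]
    · rw [Equiv.trans_apply, Equiv.swap_apply_of_ne_of_ne (by decide) (Ne.symm hb)]
      simp

/-- The symmetric group is 2-transitive on the colours, so the 4 diagonal probabilities coincide and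
so do the 12 others. -/
theorem pairProb_eq {μ : (V → Fin 4) → ℝ} (hsum : ∑ a, μ a = 1)
    (h : ∀ (π : Equiv.Perm (Fin 4)) (a : V → Fin 4), μ (fun v => π (a v)) = μ a)
    (i j : V) (b c : Fin 4) :
    pairProb μ i j b c =
      if b = c then equalProb μ i j / 4 else (1 - equalProb μ i j) / 12 := by
  have hdiag : ∀ b, pairProb μ i j b b = pairProb μ i j 0 0 := fun b => by
    simpa using pairProb_perm h (Equiv.swap 0 b) i j 0 0
  have hoff : ∀ b c, b ≠ c → pairProb μ i j b c = pairProb μ i j 0 1 := fun b c hbc => by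
    obtain ⟨π, rfl, rfl⟩ := exists_perm_pair b c hbc
    exact pairProb_perm h π i j 0 1
  have heq : equalProb μ i j = ∑ b, pairProb μ i j b b := by
    unfold equalProb pairProb
    rw [Finset.sum_comm]
    refine Finset.sum_congr rfl fun a _ => ?_
    rw [Finset.sum_eq_single (a i)]
    · simp [eq_comm]
    · intro b _ hb
      simp [hb.symm]
    · simp
  have hone : (1 : ℝ) = ∑ b, ∑ c, pairProb μ i j b c := by
    have := sum_mul_pair μ i j fun _ _ => 1
    simp only [mul_one] at this
    rw [← hsum]
    exact_mod_cast this
  simp only [hdiag, Finset.sum_const, Finset.card_univ, Fintype.card_fin, nsmul_eq_mul] at heq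
  have hone' : (1 : ℝ) = 4 * pairProb μ i j 0 0 + 12 * pairProb μ i j 0 1 := by
    rw [hone]
    simp only [Fin.sum_univ_four, hdiag]
    rw [hoff 0 2 (by decide), hoff 0 3 (by decide), hoff 1 0 (by decide), hoff 1 2 (by decide),
      hoff 1 3 (by decide), hoff 2 0 (by decide), hoff 2 1 (by decide), hoff 2 3 (by decide),
      hoff 3 0 (by decide), hoff 3 1 (by decide), hoff 3 2 (by decide)]
    ring
  push_cast at heq
  split_ifs with hbc
  · subst hbc
    rw [hdiag, heq]
    ring
  · rw [hoff b c hbc, heq]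
    linarith

theorem prod_pair_subtype {W : Type} [DecidableEq W] {i j : W} (hij : i ≠ j) (f : {v // v ∈ ({i, j} : Finset W)} → ℂ) :
    ∏ v, f v = f ⟨i, by simp⟩ * f ⟨j, by simp⟩ := by
  have hu : (Finset.univ : Finset {v // v ∈ ({i, j} : Finset W)}) =
      {⟨i, by simp⟩, ⟨j, by simp⟩} := by
    ext ⟨v, hv⟩
    refine iff_of_true (Finset.mem_univ _) ?_
    simpa using hv
  rw [hu, Finset.prod_pair]
  simpa using hij

theorem pair_funext_iff {W C : Type} [DecidableEq W] {i j : W}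
    (x y : {v // v ∈ ({i, j} : Finset W)} → C) :
    x = y ↔ x ⟨i, by simp⟩ = y ⟨i, by simp⟩ ∧ x ⟨j, by simp⟩ = y ⟨j, by simp⟩ := by
  constructor
  · rintro rfl
    simp
  · rintro ⟨hi, hj⟩
    funext ⟨v, hv⟩
    rcases Finset.mem_insert.mp hv with rfl | hv'
    · exact hi
    · obtain rfl := Finset.mem_singleton.mp hv'
      exact hj

theorem marginal_opOf {μ : (V → Fin 4) → ℝ} (hsum : ∑ a, μ a = 1)
    (h : ∀ (π : Equiv.Perm (Fin 4)) (a : V → Fin 4), μ (fun v => π (a v)) = μ a)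
    {i j : V} (hij : i ≠ j) (x y : {v // v ∈ ({i, j} : Finset V)} → Fin 2) :
    marginal {i, j} (opOf μ) x y =
      (equalProb μ i j : ℂ) * (if x = y then 1 else 0) +
        ((1 - 4 * equalProb μ i j) / 2 : ℂ) *
          singletEntry (x ⟨i, by simp⟩) (x ⟨j, by simp⟩) (y ⟨i, by simp⟩) (y ⟨j, by simp⟩) := by
  have h1 : marginal {i, j} (opOf μ) x y = ∑ a, (μ a : ℂ) *
      (dualD (a i) (x ⟨i, by simp⟩) (y ⟨i, by simp⟩) *
        dualD (a j) (x ⟨j, by simp⟩) (y ⟨j, by simp⟩)) := by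
    rw [opOf, marginal_sum_smul, Matrix.sum_apply]
    refine Finset.sum_congr rfl fun a _ => ?_
    rw [marginal_tensorOp _ _ fun v _ => trace_dualD _, Matrix.smul_apply, smul_eq_mul]
    congr 1
    rw [tensorOp, Matrix.of_apply, prod_pair_subtype hij]
  have hxy := pair_funext_iff x y
  rw [h1, sum_mul_pair μ i j fun b c => dualD b (x ⟨i, by simp⟩) (y ⟨i, by simp⟩) *
        dualD c (x ⟨j, by simp⟩) (y ⟨j, by simp⟩)]
  generalize hp : equalProb μ i j = p
  simp only [hxy, pairProb_eq hsum h, hp]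
  have hD := sum_dualD_mul_dualD (x ⟨i, by simp⟩) (x ⟨j, by simp⟩) (y ⟨i, by simp⟩) (y ⟨j, by simp⟩)
  have hi := sum_dualD (x ⟨i, by simp⟩) (y ⟨i, by simp⟩)
  have hj := sum_dualD (x ⟨j, by simp⟩) (y ⟨j, by simp⟩)
  generalize x ⟨i, by simp⟩ = x₁ at *
  generalize x ⟨j, by simp⟩ = x₂ at *
  generalize y ⟨i, by simp⟩ = y₁ at *
  generalize y ⟨j, by simp⟩ = y₂ at *
  -- The weights are a constant plus a multiple of the diagonal: the constant part factors into
  -- single sums, and the diagonal part is the 2-design sum.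
  have hsplit : ∀ b c, (((if b = c then p / 4 else (1 - p) / 12 : ℝ) : ℝ) : ℂ) *
      (dualD b x₁ y₁ * dualD c x₂ y₂) =
      (if b = c then ((4 * p - 1) / 12 : ℂ) * (dualD b x₁ y₁ * dualD b x₂ y₂) else 0) +
        ((1 - p) / 12 : ℂ) * (dualD b x₁ y₁ * dualD c x₂ y₂) := by
    intro b c
    split_ifs with hbc
    · subst hbc
      push_cast
      ring
    · push_cast
      ring
  simp only [hsplit, Finset.sum_add_distrib, Finset.sum_ite_eq, Finset.mem_univ, if_true,
    ← Finset.mul_sum, ← Finset.sum_mul, hD, hi, hj]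
  by_cases e1 : x₁ = y₁ <;> by_cases e2 : x₂ = y₂ <;> simp [e1, e2] <;> ring

/-- The numbers p and q are the eigenvalues on the triplet space and on the singlet. -/
theorem posSemidef_of_singlet {i j : V} (p q : ℝ) (hp : 0 ≤ p) (hq : 0 ≤ q)
    (M : QubitOp {v // v ∈ ({i, j} : Finset V)})
    (hM : ∀ x y, M x y = (p : ℂ) * (if x = y then 1 else 0) + ((q - p) / 2 : ℂ) *
          singletEntry (x ⟨i, by simp⟩) (x ⟨j, by simp⟩) (y ⟨i, by simp⟩) (y ⟨j, by simp⟩)) :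
    M.PosSemidef := by
  let vec (m : Fin 2 → Fin 2 → ℂ) : ({v // v ∈ ({i, j} : Finset V)} → Fin 2) → ℂ :=
    fun x => m (x ⟨i, by simp⟩) (x ⟨j, by simp⟩)
  let proj (m : Fin 2 → Fin 2 → ℂ) := Matrix.vecMulVec (vec m) (star (vec m))
  have hproj : ∀ m, (proj m).PosSemidef := fun m => Matrix.posSemidef_vecMulVec_self_star _
  have hp' : (0 : ℂ) ≤ (p : ℂ) := by exact_mod_cast hp
  have hp2 : (0 : ℂ) ≤ ((p / 2 : ℝ) : ℂ) := by exact_mod_cast (by positivity)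
  have hq2 : (0 : ℂ) ≤ ((q / 2 : ℝ) : ℂ) := by exact_mod_cast (by positivity)
  -- The eigenvectors are 00, 11, 01 + 10 and 01 - 10; the last two have squared norm 2, hence the
  -- halves.
  have hdec : M = (p : ℂ) • proj ![![1, 0], ![0, 0]] + (p : ℂ) • proj ![![0, 0], ![0, 1]] +
      ((p / 2 : ℝ) : ℂ) • proj ![![0, 1], ![1, 0]] +
        ((q / 2 : ℝ) : ℂ) • proj ![![0, 1], ![-1, 0]] := by
    ext x y
    have hxy := pair_funext_iff x y
    rw [hM]
    simp only [hxy, Matrix.add_apply, Matrix.smul_apply, proj, Matrix.vecMulVec_apply, vec,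
      Pi.star_apply, smul_eq_mul, singletEntry]
    generalize x ⟨i, by simp⟩ = x₁
    generalize x ⟨j, by simp⟩ = x₂
    generalize y ⟨i, by simp⟩ = y₁
    generalize y ⟨j, by simp⟩ = y₂
    fin_cases x₁ <;> fin_cases x₂ <;> fin_cases y₁ <;> fin_cases y₂ <;> simp <;> ring
  rw [hdec]
  exact ((((hproj _).smul hp').add ((hproj _).smul hp')).add ((hproj _).smul hp2)).add
    ((hproj _).smul hq2)

/-- A colour-invariant distribution on legal colourings is a `lam`-solution as soon as any two
distinct non-adjacent vertices agree with a probability between `lam` and `(1 - lam) / 3`. -/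
theorem isLambdaSolution_of_equalProb {lam : ℝ} (hlam : 0 ≤ lam) {G : SimpleGraph V}
    {μ : (V → Fin 4) → ℝ} (hnonneg : ∀ a, 0 ≤ μ a) (hsum : ∑ a, μ a = 1)
    (hlegal : ∀ a, 0 < μ a → ∀ u v, G.Adj u v → a u ≠ a v)
    (hinv : ∀ (π : Equiv.Perm (Fin 4)) (a : V → Fin 4), μ (fun v => π (a v)) = μ a)
    (hp : ∀ i j, i ≠ j → ¬ G.Adj i j →
      lam ≤ equalProb μ i j ∧ lam ≤ 1 - 3 * equalProb μ i j) :
    IsLambdaSolution lam G μ := by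
  -- Used with r = 0 for local positivity and with r = `lam` for non-adjacent pairs.
  have hpos : ∀ i j, i ≠ j → ∀ r : ℝ, r ≤ equalProb μ i j → r ≤ 1 - 3 * equalProb μ i j →
      (marginal {i, j} (opOf μ) - (r : ℂ) • (1 : QubitOp _)).PosSemidef := by
    intro i j hij r h1 h2
    refine posSemidef_of_singlet (equalProb μ i j - r) (1 - 3 * equalProb μ i j - r)
      (by linarith) (by linarith) _ fun x y => ?_
    rw [Matrix.sub_apply, marginal_opOf hsum hinv hij, Matrix.smul_apply, Matrix.one_apply]
    push_cast
    simp only [smul_eq_mul]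
    ring
  have hpos0 : ∀ i j, i ≠ j → 0 ≤ equalProb μ i j ∧ 0 ≤ 1 - 3 * equalProb μ i j := by
    intro i j hij
    by_cases hadj : G.Adj i j
    · have : equalProb μ i j = 0 := by
        refine Finset.sum_eq_zero fun a _ => ?_
        split_ifs with ha
        · by_contra hne
          exact hlegal a (lt_of_le_of_ne (hnonneg a) (Ne.symm hne)) i j hadj ha
        · rfl
      rw [this]
      norm_num
    · exact ⟨hlam.trans (hp i j hij hadj).1, hlam.trans (hp i j hij hadj).2⟩
  refine ⟨hnonneg, hsum, ⟨?_, ?_, ?_, ?_⟩, hlegal, hinv, fun i j hij hadj =>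
    hpos i j hij lam (hp i j hij hadj).1 (hp i j hij hadj).2⟩
  · simp only [opOf, Matrix.trace_sum, Matrix.trace_smul, trace_tensorOp, trace_dualD,
      Finset.prod_const_one, smul_eq_mul, mul_one]
    exact_mod_cast hsum
  · unfold opOf Matrix.IsHermitian
    rw [Matrix.conjTranspose_sum]
    refine Finset.sum_congr rfl fun a _ => ?_
    rw [Matrix.conjTranspose_smul, tensorOp_isHermitian fun v => dualD_isHermitian _]
    simp
  · intro a
    -- Duality of the two bases recovers the probability of `a`.
    have : (tensorOp (fun v => povmF (a v)) * opOf μ).trace = (μ a : ℂ) := by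
      simp only [opOf, Matrix.mul_sum, Matrix.mul_smul, Matrix.trace_sum, Matrix.trace_smul,
        tensorOp_mul, trace_tensorOp, trace_povmF_mul_dualD, smul_eq_mul]
      rw [Finset.sum_eq_single a]
      · simp
      · intro b _ hb
        obtain ⟨v, hv⟩ := Function.ne_iff.mp hb
        rw [Finset.prod_eq_zero (Finset.mem_univ v) (if_neg (Ne.symm hv)), mul_zero]
      · simp
    rw [this]
    exact_mod_cast hnonneg a
  · intro I hI
    obtain ⟨i, j, hij, rfl⟩ := Finset.card_eq_two.mp hI
    simpa using hpos i j hij 0 (hpos0 i j hij).1 (hpos0 i j hij).2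

end PairMarginal

/-! ### Solutions of graphs that consist of small independent blocks -/

section Blocks

/-- A coordinate of a uniformly random function is uniform, written without division. -/
theorem sum_comp_eval {B X : Type} [Fintype B] [DecidableEq B] [Fintype X] (β : B) (F : X → ℝ) :
    (∑ ω : B → X, F (ω β)) * Fintype.card X = Fintype.card (B → X) * ∑ x, F x := by
  rw [Fintype.card_congr (Equiv.funSplitAt β X), ← (Equiv.funSplitAt β X).symm.sum_comp,
    Fintype.sum_prod_type, Fintype.card_prod]
  simp only [Equiv.funSplitAt, Equiv.piSplitAt_symm_apply, dite_true, Finset.sum_const, Finset.card_univ,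
    nsmul_eq_mul, ← Finset.mul_sum]
  push_cast
  ring

theorem sum_shift_eq_one (x y : Fin 4) : ∑ k : Fin 4, (if k + x = y then (1 : ℝ) else 0) = 1 := by
  simp [← eq_sub_iff_add_eq]

variable {V B T : Type} [Fintype V] [DecidableEq V] [Fintype B] [DecidableEq B] [Fintype T]

/-- The colouring of `V` in which the colours `c v t` are permuted independently in every block. -/
def blockColor (b : V → B) (c : V → T → Fin 4) (ω : B → Equiv.Perm (Fin 4) × T) (v : V) : Fin 4 :=
  (ω (b v)).1 (c v (ω (b v)).2)

/-- The distribution of `blockColor` under the uniform distribution. -/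
noncomputable def blockDist (b : V → B) (c : V → T → Fin 4) (a : V → Fin 4) : ℝ :=
  ∑ ω : B → Equiv.Perm (Fin 4) × T,
    if blockColor b c ω = a then (Fintype.card (B → Equiv.Perm (Fin 4) × T) : ℝ)⁻¹ else 0

variable (b : V → B) (c : V → T → Fin 4)

theorem sum_blockDist_mul (F : (V → Fin 4) → ℝ) :
    ∑ a, F a * blockDist b c a =
      (∑ ω, F (blockColor b c ω)) / Fintype.card (B → Equiv.Perm (Fin 4) × T) := by
  simp only [blockDist, Finset.mul_sum]
  rw [Finset.sum_comm, Finset.sum_div]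
  refine Finset.sum_congr rfl fun ω _ => ?_
  simp [div_eq_mul_inv]

theorem equalProb_blockDist (i j : V) :
    equalProb (blockDist b c) i j =
      (∑ ω, if blockColor b c ω i = blockColor b c ω j then (1 : ℝ) else 0) /
        Fintype.card (B → Equiv.Perm (Fin 4) × T) := by
  rw [← sum_blockDist_mul b c fun a => if a i = a j then 1 else 0]
  simp [equalProb]

/-- Both colours pass through the same permutation, which cancels; only the uniform parameter in `T`
remains. -/
theorem equalProb_blockDist_of_eq [Nonempty T] {i j : V} (h : b i = b j) :
    equalProb (blockDist b c) i j =
      (∑ t, if c i t = c j t then (1 : ℝ) else 0) / Fintype.card T := by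
  have key := sum_comp_eval (X := Equiv.Perm (Fin 4) × T) (b j)
    fun x => if c i x.2 = c j x.2 then 1 else 0
  have hprod : (∑ x : Equiv.Perm (Fin 4) × T, if c i x.2 = c j x.2 then (1 : ℝ) else 0) =
      Fintype.card (Equiv.Perm (Fin 4)) * ∑ t, if c i t = c j t then (1 : ℝ) else 0 := by
    rw [Fintype.sum_prod_type]
    change ∑ _ : Equiv.Perm (Fin 4), ∑ t, (if c i t = c j t then (1 : ℝ) else 0) = _
    rw [Finset.sum_const, Finset.card_univ, nsmul_eq_mul]
  rw [hprod, Fintype.card_prod] at key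
  rw [equalProb_blockDist]
  simp only [blockColor, h, EmbeddingLike.apply_eq_iff_eq]
  have h1 : (Fintype.card (B → Equiv.Perm (Fin 4) × T) : ℝ) ≠ 0 :=
    Nat.cast_ne_zero.mpr Fintype.card_ne_zero
  have h2 : (Fintype.card T : ℝ) ≠ 0 := Nat.cast_ne_zero.mpr Fintype.card_ne_zero
  have h3 : (Fintype.card (Equiv.Perm (Fin 4)) : ℝ) ≠ 0 := Nat.cast_ne_zero.mpr Fintype.card_ne_zero
  rw [div_eq_div_iff h1 h2]
  apply mul_right_cancel₀ h3
  push_cast at key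
  linear_combination key

/-- Shifting the colours in the block of `i` alone by `k` preserves the uniform distribution, and
exactly one of the four shifts makes the two colours agree. -/
theorem equalProb_blockDist_of_ne [Nonempty T] {i j : V} (h : b i ≠ b j) :
    equalProb (blockDist b c) i j = 1 / 4 := by
  have hk : ∀ k : Fin 4,
      (∑ ω, if blockColor b c ω i = blockColor b c ω j then (1 : ℝ) else 0) =
        ∑ ω, if k + blockColor b c ω i = blockColor b c ω j then (1 : ℝ) else 0 := by
    intro k
    rw [← (Equiv.piCongrRight fun β : B => if β = b i then
      (Equiv.prodCongr (Equiv.mulLeft (Equiv.addLeft k)) (Equiv.refl T) :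
        Equiv.Perm (Equiv.Perm (Fin 4) × T)) else Equiv.refl _).sum_comp]
    refine Finset.sum_congr rfl fun ω _ => ?_
    simp [blockColor, h.symm]
    congr
  have hsum : (∑ ω, if blockColor b c ω i = blockColor b c ω j then (1 : ℝ) else 0) * 4 =
      Fintype.card (B → Equiv.Perm (Fin 4) × T) := by
    have : ∑ k : Fin 4, ∑ ω, (if k + blockColor b c ω i = blockColor b c ω j then (1 : ℝ) else 0) =
        Fintype.card (B → Equiv.Perm (Fin 4) × T) := by
      rw [Finset.sum_comm]
      simp only [sum_shift_eq_one]
      simp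
    rw [← this]
    simp only [← hk]
    simp [mul_comm]
  have h1 : (Fintype.card (B → Equiv.Perm (Fin 4) × T) : ℝ) ≠ 0 :=
    Nat.cast_ne_zero.mpr Fintype.card_ne_zero
  rw [equalProb_blockDist, div_eq_div_iff h1 (by norm_num), hsum, one_mul]

omit [DecidableEq V] in
theorem blockDist_perm (π : Equiv.Perm (Fin 4)) (a : V → Fin 4) :
    blockDist b c (fun v => π (a v)) = blockDist b c a := by
  unfold blockDist
  rw [← (Equiv.piCongrRight fun _ : B =>
      (Equiv.prodCongr (Equiv.mulLeft π) (Equiv.refl T) :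
        Equiv.Perm (Equiv.Perm (Fin 4) × T))).sum_comp]
  refine Finset.sum_congr rfl fun ω _ => ?_
  congr 1
  simp [blockColor, funext_iff]

/-- A graph all of whose edges lie inside blocks has a solution if every block has one. -/
theorem isLambdaSolution_blockDist [Nonempty T] {lam : ℝ} (h0 : 0 ≤ lam) (h1 : lam ≤ 1 / 4)
    {G : SimpleGraph V}
    (hadj : ∀ u v, G.Adj u v → b u = b v ∧ ∀ t, c u t ≠ c v t)
    (hnon : ∀ u v, u ≠ v → ¬ G.Adj u v → b u = b v →
      lam ≤ (∑ t, if c u t = c v t then (1 : ℝ) else 0) / Fintype.card T ∧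
        lam ≤ 1 - 3 * ((∑ t, if c u t = c v t then (1 : ℝ) else 0) / Fintype.card T)) :
    IsLambdaSolution lam G (blockDist b c) := by
  refine isLambdaSolution_of_equalProb h0 ?_ ?_ ?_ (blockDist_perm b c) ?_
  · intro a
    refine Finset.sum_nonneg fun ω _ => ?_
    split_ifs <;> positivity
  · have h := sum_blockDist_mul b c fun _ => 1
    simp only [one_mul, Finset.sum_const, Finset.card_univ, nsmul_eq_mul, mul_one] at h
    rw [h, div_self (Nat.cast_ne_zero.mpr Fintype.card_ne_zero)]
  · intro a ha u v huv heq
    obtain ⟨ω, -, hω⟩ := Finset.exists_ne_zero_of_sum_ne_zero ha.ne'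
    have hω' : blockColor b c ω = a := by
      by_contra hne
      exact hω (if_neg hne)
    rw [← hω'] at heq
    obtain ⟨hb, hc⟩ := hadj u v huv
    simp only [blockColor, hb, EmbeddingLike.apply_eq_iff_eq] at heq
    exact hc _ heq
  · intro i j hij hadj'
    by_cases hb : b i = b j
    · rw [equalProb_blockDist_of_eq b c hb]
      exact hnon i j hij hadj' hb
    · rw [equalProb_blockDist_of_ne b c hb]
      constructor <;> linarith

/-- The edges of `G` lie inside blocks, and every block has a random legal colouring in which
distinct non-adjacent vertices agree with a probability between `lam` and `(1 - lam) / 3`. -/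
def HasBlockColoring {V : Type} (lam : ℝ) (G : SimpleGraph V) : Prop :=
  ∃ (B T : Type) (_ : Fintype B) (_ : DecidableEq B) (_ : Fintype T) (_ : Nonempty T)
    (b : V → B) (c : V → T → Fin 4),
    (∀ u v, G.Adj u v → b u = b v ∧ ∀ t, c u t ≠ c v t) ∧
      ∀ u v, u ≠ v → ¬ G.Adj u v → b u = b v →
        lam ≤ (∑ t, if c u t = c v t then (1 : ℝ) else 0) / Fintype.card T ∧
          lam ≤ 1 - 3 * ((∑ t, if c u t = c v t then (1 : ℝ) else 0) / Fintype.card T)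

theorem HasBlockColoring.exists_isLambdaSolution {lam : ℝ} {G : SimpleGraph V}
    (h : HasBlockColoring lam G) (h0 : 0 ≤ lam) (h1 : lam ≤ 1 / 4) :
    ∃ μ, IsLambdaSolution lam G μ := by
  obtain ⟨B, T, _, _, _, _, b, c, hadj, hnon⟩ := h
  exact ⟨_, isLambdaSolution_blockDist b c h0 h1 hadj hnon⟩

theorem HasBlockColoring.comap {V W : Type} {lam : ℝ} {G : SimpleGraph W}
    (h : HasBlockColoring lam G) {f : V → W} (hf : Function.Injective f) :
    HasBlockColoring lam (G.comap f) := by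
  obtain ⟨B, T, i1, i2, i3, i4, b, c, hadj, hnon⟩ := h
  exact ⟨B, T, i1, i2, i3, i4, b ∘ f, c ∘ f, fun u v huv => hadj _ _ huv,
    fun u v huv hn hb => hnon _ _ (hf.ne huv) hn hb⟩

end Blocks

/-! ### The graph of the reduction -/

section Gadget

/-- The vertices of the constructed graph: every ordered pair of vertices of the given graph owns
ten of them. -/
abbrev Cell (n : ℕ) : Type := Fin 10 × Fin n × Fin n

/-- The edges between the vertices of the block of an ordered pair `(u, v)` of neighbours and the
block at the position `cellPos l (u, v)`: the first part consists of two copies of `K₄`, the other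
two of stars. -/
def slotEdge (l k k' : ℕ) : Bool :=
  if l = 0 then decide (k ≠ k' ∧ k / 4 = k' / 4 ∧ k < 8)
  else if l = 1 then
    decide ((k = 8 ∧ k' ∈ [1, 2, 3]) ∨ (k = 9 ∧ k' ∈ [0, 5, 6, 7]))
  else decide ((k = 8 ∧ k' ∈ [1, 2, 3]) ∨ (k = 9 ∧ k' ∈ [0, 4, 6, 7]))

/-- The position of the hubs which the block of the pair `p` is joined to in the part `l`. -/
def cellPos {α : Type} (l : ℕ) (p : α × α) : α × α :=
  if l = 0 then p else if l = 1 then (p.1, p.1) else (p.2, p.2)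

variable {n : ℕ}

/-- The oriented version of adjacency in the part `l`. -/
def gadgetRel (A : SimpleGraph (Fin n)) (l : Fin 3) (w w' : Cell n) : Prop :=
  A.Adj w'.2.1 w'.2.2 ∧ slotEdge l w.1 w'.1 = true ∧ w.2 = cellPos l w'.2

theorem slotEdge_ne : ∀ (l : Fin 3) (k k' : Fin 10), slotEdge l k k' = true → k ≠ k' := by decide

/-- The part `l` of the constructed graph. -/
def gadgetPart (A : SimpleGraph (Fin n)) (l : Fin 3) : SimpleGraph (Cell n) where
  Adj w w' := gadgetRel A l w w' ∨ gadgetRel A l w' w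
  symm := ⟨fun _ _ h => h.symm⟩
  loopless := ⟨fun w h => by
    rcases h with h | h <;> exact slotEdge_ne l _ _ h.2.1 rfl⟩

/-! #### Solutions of the parts -/

/-- The representative of a vertex of a copy of `K₄`. -/
def cliqueRep (k : Fin 10) : Fin 10 := if k < 4 then 0 else if k < 8 then 4 else k

theorem cliqueRep_eq_iff : ∀ k k' : Fin 10,
    cliqueRep k = cliqueRep k' ↔ k = k' ∨ slotEdge 0 k k' = true := by decide

theorem slotEdge_zero_mod : ∀ k k' : Fin 10, slotEdge 0 k k' = true →
    Fin.ofNat 4 k ≠ Fin.ofNat 4 k' := by decide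

/-- The blocks are copies of K₄ and single vertices, so none contains two distinct non-adjacent
vertices; this is why `lam` is arbitrary. -/
theorem hasBlockColoring_gadgetPart_zero {lam : ℝ} (A : SimpleGraph (Fin n)) :
    HasBlockColoring lam (gadgetPart A 0) := by
  classical
  refine ⟨Cell n, Unit, inferInstance, inferInstance, inferInstance, inferInstance,
    fun w => (if A.Adj w.2.1 w.2.2 then cliqueRep w.1 else w.1, w.2), fun w _ => Fin.ofNat 4 w.1,
    ?_, ?_⟩
  · have key : ∀ w w', gadgetRel A 0 w w' →
        ((if A.Adj w.2.1 w.2.2 then cliqueRep w.1 else w.1, w.2) : Cell n) =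
          (if A.Adj w'.2.1 w'.2.2 then cliqueRep w'.1 else w'.1, w'.2) ∧
        ∀ _ : Unit, Fin.ofNat 4 w.1 ≠ Fin.ofNat 4 w'.1 := by
      rintro ⟨k, p⟩ ⟨k', p'⟩ ⟨h1, h2, h3⟩
      obtain rfl : p = p' := h3
      refine ⟨?_, fun _ => slotEdge_zero_mod _ _ h2⟩
      simp only [if_pos h1, (cliqueRep_eq_iff k k').mpr (Or.inr h2)]
    rintro w w' (h | h)
    · exact key w w' h
    · exact ⟨(key w' w h).1.symm, fun t => ((key w' w h).2 t).symm⟩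
  · rintro ⟨k, p⟩ ⟨k', p'⟩ hne hadj hb
    exfalso
    obtain ⟨hk, rfl⟩ := Prod.mk.inj hb
    dsimp only at hk
    split_ifs at hk with h1
    · rcases (cliqueRep_eq_iff k k').mp hk with rfl | h
      · exact hne rfl
      · exact hadj (Or.inl ⟨h1, h, rfl⟩)
    · exact hne (by rw [hk])

/-! ### Random colourings of the star parts -/

/-- The hub that a slot is joined to in the part `l`; slots without a hub are mapped to
themselves. -/
def starHub (l : Fin 3) (k : Fin 10) : Fin 10 :=
  if slotEdge l 8 k then 8 else if slotEdge l 9 k then 9 else k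

theorem slotEdge_iff_starHub : ∀ (l : Fin 3) (h k : Fin 10), l ≠ 0 →
    (slotEdge l h k = true ↔ starHub l k = h ∧ h ≠ k) := by decide

theorem starHub_of_slotEdge : ∀ (l : Fin 3) (h k : Fin 10), l ≠ 0 →
    slotEdge l h k = true → starHub l h = h := by decide

/-- A numbering of the leaves of the stars that belong to the same block. -/
def starSlot (k : Fin 10) : Fin 4 := ![0, 1, 2, 3, 1, 1, 2, 3, 0, 0] k

/-- Slots 4 and 5 can share a number, since each star part joins only one of them to a hub. -/
theorem starSlot_inj : ∀ (l : Fin 3) (k k' : Fin 10), l ≠ 0 → starHub l k ≠ k →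
    starHub l k' ≠ k' → starHub l k = starHub l k' → starSlot k = starSlot k' → k = k' := by
  decide

/-- The colour of the leaf `m` of a star in the random colouring with parameter `t`: up to a shift
it is the scalar product of the digit vectors of `m` and `t + 1` over the field with three
elements. -/
def starColor (m t : ℕ) : Fin 4 :=
  Fin.ofNat 4 (1 + ((m % 3) * ((t + 1) % 3) + (m / 3 % 3) * ((t + 1) / 3 % 3) +
    (m / 9) * ((t + 1) / 9)) % 3)

theorem starColor_ne_zero (m t : ℕ) : starColor m t ≠ 0 := by
  unfold starColor
  have h := Nat.mod_lt ((m % 3) * ((t + 1) % 3) + (m / 3 % 3) * ((t + 1) / 3 % 3) +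
    (m / 9) * ((t + 1) / 9)) (show 0 < 3 by norm_num)
  generalize _ % 3 = r at h
  interval_cases r <;> decide

/-- As `t + 1` runs over the 26 non-zero vectors of 𝔽₃³, those orthogonal to the non-zero difference
of the digit vectors form a plane without its origin: 9 - 1 = 8. Omitting the zero vector brings the
probability below 1/3. -/
theorem card_starColor_eq : ∀ m m' : Fin 16, m ≠ m' →
    (Finset.univ.filter fun t : Fin 26 => starColor m t = starColor m' t).card = 8 := by
  decide +kernel

theorem exists_injOn_fin_four {α : Type} [Finite α] (s : Set α) (h : s.ncard ≤ 4) :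
    ∃ r : α → Fin 4, Set.InjOn r s := by
  classical
  have := Fintype.ofFinite s
  have hc : Fintype.card s ≤ Fintype.card (Fin 4) := by
    rwa [← Nat.card_eq_fintype_card, Nat.card_coe_set_eq, Fintype.card_fin]
  obtain ⟨g⟩ := Function.Embedding.nonempty_of_card_le hc
  refine ⟨fun a => if ha : a ∈ s then g ⟨a, ha⟩ else 0, fun a ha a' ha' haa' => ?_⟩
  simp only [dif_pos ha, dif_pos ha'] at haa'
  simpa using g.injective haa'

theorem cellPos_far {l : Fin 3} (hl : l ≠ 0) {p q : Fin n × Fin n}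
    (h : cellPos l p = cellPos l q) (hfar : (if l = 1 then p.2 else p.1) = if l = 1 then q.2 else q.1) :
    p = q := by
  fin_cases l
  · exact absurd rfl hl
  all_goals
    simp [cellPos] at h hfar
    exact Prod.ext (by assumption) (by assumption)

theorem adj_cellPos_far (A : SimpleGraph (Fin n)) {l : Fin 3} (hl : l ≠ 0) {p : Fin n × Fin n}
    (h : A.Adj p.1 p.2) : A.Adj (cellPos l p).1 (if l = 1 then p.2 else p.1) := by
  fin_cases l
  · exact absurd rfl hl
  · simpa [cellPos] using h
  · simpa [cellPos] using h.symm

theorem hasBlockColoring_gadgetPart_star {lam : ℝ} (hlam : lam ≤ 1 / 13) (A : SimpleGraph (Fin n))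
    (hA : ∀ v, (A.neighborSet v).ncard ≤ 4) {l : Fin 3} (hl : l ≠ 0) :
    HasBlockColoring lam (gadgetPart A l) := by
  classical
  choose r hr using fun v => exists_injOn_fin_four (A.neighborSet v) (hA v)
  let leaf (w : Cell n) : Prop := A.Adj w.2.1 w.2.2 ∧ starHub l w.1 ≠ w.1
  -- A leaf of a given star is determined by the far vertex of its pair, one of at most four
  -- neighbours, and by one of four slots.
  let label (w : Cell n) : Fin 16 :=
    finProdFinEquiv (r (cellPos l w.2).1 (if l = 1 then w.2.2 else w.2.1), starSlot w.1)
  refine ⟨Cell n, Fin 26, inferInstance, inferInstance, inferInstance, inferInstance,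
    fun w => if leaf w then (starHub l w.1, cellPos l w.2) else w,
    fun w t => if leaf w then starColor (label w) t else 0, ?_, ?_⟩
  · have key : ∀ w w', gadgetRel A l w w' → ¬ leaf w ∧ leaf w' ∧
        w = (starHub l w'.1, cellPos l w'.2) := by
      rintro ⟨k, p⟩ ⟨k', p'⟩ ⟨h1, h2, h3⟩
      have hk := (slotEdge_iff_starHub l k k' hl).mp h2
      exact ⟨fun h => h.2 (starHub_of_slotEdge l k k' hl h2), ⟨h1, by rw [hk.1]; exact hk.2⟩,
        Prod.ext hk.1.symm h3⟩
    rintro w w' (h | h)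
    · obtain ⟨h1, h2, h3⟩ := key _ _ h
      simp only [if_neg h1, if_pos h2]
      exact ⟨h3, fun t => (starColor_ne_zero _ _).symm⟩
    · obtain ⟨h1, h2, h3⟩ := key _ _ h
      simp only [if_neg h1, if_pos h2]
      exact ⟨h3.symm, fun t => starColor_ne_zero _ _⟩
  · have key : ∀ w w', leaf w → ¬ leaf w' → (starHub l w.1, cellPos l w.2) = w' →
        gadgetRel A l w' w := by
      rintro w w' h1 _ rfl
      exact ⟨h1.1, (slotEdge_iff_starHub l _ _ hl).mpr ⟨rfl, h1.2⟩, rfl⟩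
    intro w w' hne hadj hb
    by_cases h1 : leaf w <;> by_cases h2 : leaf w'
    · simp only [if_pos h1, if_pos h2] at hb ⊢
      obtain ⟨hk, hp⟩ := Prod.mk.inj hb
      have hlab : label w ≠ label w' := by
        intro heq
        obtain ⟨e1, e2⟩ := Prod.mk.inj (finProdFinEquiv.injective heq)
        rw [hp] at e1
        have e3 := hr _ (hp ▸ adj_cellPos_far A hl h1.1) (adj_cellPos_far A hl h2.1) e1
        exact hne (Prod.ext (starSlot_inj l _ _ hl h1.2 h2.2 hk e2) (cellPos_far hl hp e3))
      rw [Finset.sum_boole, card_starColor_eq _ _ hlab, Fintype.card_fin]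
      -- Here p = 8/26 = 4/13, and 1 - 3p = 1/13 is the binding constraint.
      constructor <;> norm_num <;> linarith
    · simp only [if_pos h1, if_neg h2] at hb
      exact absurd (Or.inr (key _ _ h1 h2 hb)) hadj
    · simp only [if_neg h1, if_pos h2] at hb
      exact absurd (Or.inl (key _ _ h2 h1 hb.symm)) hadj
    · simp only [if_neg h1, if_neg h2] at hb
      exact absurd hb hne

theorem hasBlockColoring_gadgetPart (A : SimpleGraph (Fin n))
    (hA : ∀ v, (A.neighborSet v).ncard ≤ 4) (l : Fin 3) :
    HasBlockColoring (1 / 13) (gadgetPart A l) := by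
  by_cases hl : l = 0
  · subst hl
    exact hasBlockColoring_gadgetPart_zero A
  · exact hasBlockColoring_gadgetPart_star le_rfl A hA hl

end Gadget

/-! ### Programs that enumerate lists -/

section Emits

/-- Started in `s`, the program `P` appends `o` to the output within `T` steps, and changes neither
the memory nor the registers below `m`. -/
def Emits (P : RamProg) (m : ℕ) (s : RamState) (T : ℕ) (o : List ℕ) : Prop :=
  ∃ (s' : RamState) (t : ℕ), RamRuns P s s' t ∧ t ≤ T ∧ s'.mem = s.mem ∧ s'.out = s.out ++ o ∧
    ∀ r < m, s'.reg r = s.reg r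

theorem Emits.seq {P Q : RamProg} {m : ℕ} {s : RamState} {T T' : ℕ} {o o' : List ℕ}
    (hP : Emits P m s T o)
    (hQ : ∀ s' : RamState, s'.mem = s.mem → (∀ r < m, s'.reg r = s.reg r) → Emits Q m s' T' o') :
    Emits (.seq P Q) m s (T + T') (o ++ o') := by
  obtain ⟨s₁, t₁, h₁, ht₁, hm₁, ho₁, hr₁⟩ := hP
  obtain ⟨s₂, t₂, h₂, ht₂, hm₂, ho₂, hr₂⟩ := hQ s₁ hm₁ hr₁
  exact ⟨s₂, t₁ + t₂, .seq h₁ h₂, by omega, hm₂.trans hm₁, by rw [ho₂, ho₁, List.append_assoc],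
    fun r hr => (hr₂ r hr).trans (hr₁ r hr)⟩

/-- Run `P 0`, …, `P (K - 1)` in turn; `m` is a scratch register. -/
def unrollProg (m : ℕ) (P : ℕ → RamProg) : ℕ → RamProg
  | 0 => .const m 0
  | K + 1 => .seq (unrollProg m P K) (P K)

theorem emits_unrollProg {P : ℕ → RamProg} {m K : ℕ} {s : RamState} {T : ℕ} {o : ℕ → List ℕ}
    (h : ∀ k < K, ∀ s' : RamState, s'.mem = s.mem → (∀ r < m, s'.reg r = s.reg r) →
      Emits (P k) m s' T (o k)) :
    Emits (unrollProg m P K) m s (K * T + 1) ((List.range K).flatMap o) := by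
  induction K with
  | zero =>
    refine ⟨_, _, .const _ _ _, by omega, rfl, by simp, fun r hr => ?_⟩
    simp [Function.update_of_ne hr.ne]
  | succ K ih =>
    have := (ih fun k hk => h k (by omega)).seq (h K (by omega))
    rw [List.range_succ, List.flatMap_append, List.flatMap_singleton, Nat.succ_mul]
    rwa [show K * T + T + 1 = K * T + 1 + T by omega]

/-- The body of the loop in `forProg`. -/
def forStep (m : ℕ) (P : RamProg) : RamProg :=
  .seq P (.seq (.add m m 2) (.seq (.sub (m + 1) (m + 1) 2) (.add (m + 2) (m + 2) 1)))

/-- Run `P` for the values `0`, …, `n - 1` of register `m`, where `n` is the content of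
register `1`; register `m + 2` contains the multiples of `n`, and register `2` must contain `1`. -/
def forProg (m : ℕ) (P : RamProg) : RamProg :=
  .seq (.const m 0) (.seq (.const (m + 1) 0) (.seq (.add (m + 1) (m + 1) 1)
    (.seq (.const (m + 2) 0) (.loop (m + 1) (forStep m P)))))

/-- Induction on the number `d` of remaining rounds; each costs the body, three register updates and
one test. -/
theorem emits_forLoop {P : RamProg} {m n : ℕ} {s : RamState} {T : ℕ} {o : ℕ → List ℕ}
    (hm : 3 ≤ m) (h1 : s.reg 1 = n) (h2 : s.reg 2 = 1)
    (h : ∀ j < n, ∀ s' : RamState, s'.mem = s.mem → (∀ r < m, s'.reg r = s.reg r) →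
      s'.reg m = j → s'.reg (m + 2) = j * n → Emits P (m + 3) s' T (o j))
    (d j : ℕ) (s₀ : RamState) (hd : j + d = n) (hmem : s₀.mem = s.mem)
    (hreg : ∀ r < m, s₀.reg r = s.reg r) (hj : s₀.reg m = j) (hc : s₀.reg (m + 1) = d)
    (hj2 : s₀.reg (m + 2) = j * n) :
    Emits (.loop (m + 1) (forStep m P)) m s₀ (d * (T + 4) + 1) ((List.range' j d).flatMap o) := by
  induction d generalizing j s₀ with
  | zero => exact ⟨s₀, 1, RamRuns.loop_stop hc, by omega, rfl, by simp, fun _ _ => rfl⟩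
  | succ d ih =>
    obtain ⟨s₁, t₁, r₁, ht₁, hm₁, ho₁, hr₁⟩ := h j (by omega) s₀ hmem hreg hj hj2
    have e1 : s₁.reg 1 = n := by rw [hr₁ 1 (by omega), hreg 1 (by omega), h1]
    have e2 : s₁.reg 2 = 1 := by rw [hr₁ 2 (by omega), hreg 2 (by omega), h2]
    have e3 : s₁.reg m = j := by rw [hr₁ m (by omega), hj]
    have e4 : s₁.reg (m + 1) = d + 1 := by rw [hr₁ _ (by omega), hc]
    have e5 : s₁.reg (m + 2) = j * n := by rw [hr₁ _ (by omega), hj2]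
    let f := Function.update (Function.update (Function.update s₁.reg m (j + 1)) (m + 1) d) (m + 2)
      ((j + 1) * n)
    have hstep : RamRuns (forStep m P) s₀ { s₁ with reg := f } (t₁ + (1 + (1 + 1))) := by
      refine .seq r₁ (.seq (.add _ _ _ _) (.seq (.sub _ _ _ _) ?_))
      convert! RamRuns.add (m + 2) (m + 2) 1 _ using 1
      have a3 : (2 : ℕ) ≠ m := by omega
      have u1 : Function.update (Function.update s₁.reg m (j + 1)) (m + 1) d 1 = n := by
        rw [Function.update_of_ne (by omega), Function.update_of_ne (by omega), e1]
      simp [f, u1, e2, e3, e4, e5, Function.update_of_ne, a3, Nat.succ_mul]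
    have f_lt : ∀ r < m, f r = s₁.reg r := fun r hr => by
      simp only [f]
      rw [Function.update_of_ne (by omega), Function.update_of_ne (by omega),
        Function.update_of_ne (by omega)]
    obtain ⟨s₂, t₂, r₂, ht₂, hm₂, ho₂, hr₂⟩ := ih (j + 1) { s₁ with reg := f } (by omega)
      (hm₁.trans hmem)
      (fun r hr => by rw [← hreg r hr, ← hr₁ r (by omega)]; exact f_lt r hr)
      (by simp [f]) (by simp [f]) (by simp [f])
    refine ⟨s₂, t₁ + (1 + (1 + 1)) + t₂ + 1, .loop_step (by omega) hstep r₂, ?_, hm₂.trans hm₁, ?_,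
      fun r hr => ?_⟩
    · rw [Nat.succ_mul]
      omega
    · rw [ho₂, ho₁]
      simp [List.range'_succ]
    · rw [hr₂ r hr, ← hr₁ r (by omega)]
      exact f_lt r hr

theorem emits_forProg {P : RamProg} {m n : ℕ} {s : RamState} {T : ℕ} {o : ℕ → List ℕ}
    (hm : 3 ≤ m) (h1 : s.reg 1 = n) (h2 : s.reg 2 = 1)
    (h : ∀ j < n, ∀ s' : RamState, s'.mem = s.mem → (∀ r < m, s'.reg r = s.reg r) →
      s'.reg m = j → s'.reg (m + 2) = j * n → Emits P (m + 3) s' T (o j)) :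
    Emits (forProg m P) m s (n * (T + 4) + 5) ((List.range n).flatMap o) := by
  have u1 : Function.update (Function.update s.reg m 0) (m + 1) 0 1 = n := by
    rw [Function.update_of_ne (by omega), Function.update_of_ne (by omega), h1]
  let f := Function.update (Function.update (Function.update s.reg m 0) (m + 1) n) (m + 2) 0
  have f_lt : ∀ r < m, f r = s.reg r := fun r hr => by
    simp only [f]
    rw [Function.update_of_ne (by omega), Function.update_of_ne (by omega),
      Function.update_of_ne (by omega)]
  obtain ⟨s₂, t₂, r₂, ht₂, hm₂, ho₂, hr₂⟩ := emits_forLoop hm h1 h2 h n 0 { s with reg := f }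
    (by omega) rfl f_lt (by simp [f]) (by simp [f]) (by simp [f])
  refine ⟨s₂, 1 + (1 + (1 + (1 + t₂))), ?_, by omega, hm₂, ?_, fun r hr => ?_⟩
  · refine .seq (.const _ _ _) (.seq (.const _ _ _) (.seq (.add _ _ _ _) (.seq (.const _ _ _) ?_)))
    convert! r₂ using 2
    simp [f, u1]
  · rw [ho₂, List.range_eq_range']
  · rw [hr₂ r hr]
    exact f_lt r hr

end Emits

/-! ### The program of the reduction -/

section Program

/-- Started in `s`, the program `P` puts `x` into register `18` within `T` steps, and changes
neither the memory nor the output nor the registers below `15`. -/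
def Marks (P : RamProg) (s : RamState) (T x : ℕ) : Prop :=
  ∃ (s' : RamState) (t : ℕ), RamRuns P s s' t ∧ t ≤ T ∧ s'.mem = s.mem ∧ s'.out = s.out ∧
    (∀ r < 15, s'.reg r = s.reg r) ∧ s'.reg 18 = x

theorem Marks.seq {P Q : RamProg} {s : RamState} {T T' x y : ℕ} (hP : Marks P s T x)
    (hQ : ∀ s' : RamState, s'.mem = s.mem → (∀ r < 15, s'.reg r = s.reg r) → s'.reg 18 = x →
      Marks Q s' T' y) :
    Marks (.seq P Q) s (T + T') y := by
  obtain ⟨s₁, t₁, h₁, ht₁, hm₁, ho₁, hr₁, hx₁⟩ := hP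
  obtain ⟨s₂, t₂, h₂, ht₂, hm₂, ho₂, hr₂, hx₂⟩ := hQ s₁ hm₁ hr₁ hx₁
  exact ⟨s₂, t₁ + t₂, .seq h₁ h₂, by omega, hm₂.trans hm₁, ho₂.trans ho₁,
    fun r hr => (hr₂ r hr).trans (hr₁ r hr), hx₂⟩

/-- Put `c` into register `18` if the registers `h₁`, `h₂` have the same contents as `p₁`, `p₂` and
the memory cell whose address is one more than the sum of the registers `a₁`, `a₂` is not `0`. -/
def testProg (c h₁ h₂ p₁ p₂ a₁ a₂ : ℕ) : RamProg :=
  .seq (.const 15 1) <| .seq (.add 15 15 a₁) <| .seq (.add 15 15 a₂) <| .seq (.load 15 15) <|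
  .seq (.sub 16 h₁ p₁) <| .seq (.sub 17 p₁ h₁) <| .seq (.add 16 16 17) <|
  .seq (.sub 17 h₂ p₂) <| .seq (.add 16 16 17) <| .seq (.sub 17 p₂ h₂) <| .seq (.add 16 16 17) <|
  .ite 16 (.const 17 0) (.ite 15 (.const 18 c) (.const 17 0))

/-- With truncated subtraction, (x - y) + (y - x) vanishes only for x = y, so register 16 ends up 0
exactly when both coordinates agree. Writing 0 into register 17 serves as an idle branch. -/
theorem marks_testProg {c h₁ h₂ p₁ p₂ a₁ a₂ : ℕ} (s : RamState) (b₁ : h₁ < 15) (b₂ : h₂ < 15)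
    (b₃ : p₁ < 15) (b₄ : p₂ < 15) (b₅ : a₁ < 15) (b₆ : a₂ < 15) :
    Marks (testProg c h₁ h₂ p₁ p₂ a₁ a₂) s 14
      (if s.reg h₁ = s.reg p₁ ∧ s.reg h₂ = s.reg p₂ ∧ s.mem (1 + s.reg a₁ + s.reg a₂) ≠ 0 then c
        else s.reg 18) := by
  have ne : ∀ x y, x < 15 → 15 ≤ y → x ≠ y := fun x y _ _ => by omega
  let v15 := s.mem (1 + s.reg a₁ + s.reg a₂)
  let v16 := s.reg h₁ - s.reg p₁ + (s.reg p₁ - s.reg h₁) + (s.reg h₂ - s.reg p₂) +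
    (s.reg p₂ - s.reg h₂)
  let f := Function.update (Function.update (Function.update s.reg 15 v15) 16 v16) 17
    (s.reg p₂ - s.reg h₂)
  have hpre : ∀ Q s' t, RamRuns Q { s with reg := f } s' t →
      RamRuns (.seq (.const 15 1) <| .seq (.add 15 15 a₁) <| .seq (.add 15 15 a₂) <|
        .seq (.load 15 15) <| .seq (.sub 16 h₁ p₁) <| .seq (.sub 17 p₁ h₁) <|
        .seq (.add 16 16 17) <| .seq (.sub 17 h₂ p₂) <| .seq (.add 16 16 17) <|
        .seq (.sub 17 p₂ h₂) <| .seq (.add 16 16 17) Q) s s' (11 + t) := by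
    intro Q s' t hQ
    have ht : 11 + t = 1 + (1 + (1 + (1 + (1 + (1 + (1 + (1 + (1 + (1 + (1 + t)))))))))) := by omega
    rw [ht]
    refine .seq (.const _ _ _) <| .seq (.add _ _ _ _) <| .seq (.add _ _ _ _) <|
      .seq (.load _ _ _) <| .seq (.sub _ _ _ _) <| .seq (.sub _ _ _ _) <| .seq (.add _ _ _ _) <|
      .seq (.sub _ _ _ _) <| .seq (.add _ _ _ _) <| .seq (.sub _ _ _ _) <| .seq (.add _ _ _ _) ?_
    convert! hQ using 2
    funext r
    by_cases r17 : r = 17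
    · subst r17
      simp [f, Function.update_of_ne, ne, b₁, b₂, b₃, b₄, b₅, b₆]
    by_cases r16 : r = 16
    · subst r16
      simp [f, v16, Function.update_of_ne, ne, b₁, b₂, b₃, b₄, b₅, b₆]
    by_cases r15 : r = 15
    · subst r15
      simp [f, v15, Function.update_of_ne, ne, b₁, b₂, b₃, b₄, b₅, b₆]
    simp [f, Function.update_of_ne, r17, r16, r15]
  have f_lt : ∀ r < 15, f r = s.reg r := fun r hr => by
    simp only [f]
    rw [Function.update_of_ne (by omega), Function.update_of_ne (by omega),
      Function.update_of_ne (by omega)]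
  have f15 : f 15 = v15 := by simp [f]
  have f16 : f 16 = v16 := by simp [f]
  have f18 : f 18 = s.reg 18 := by simp [f]
  by_cases hv : v16 = 0
  · by_cases hw : v15 = 0
    · refine ⟨_, _, hpre _ _ _ (.ite_neg (f16.trans hv) (.ite_neg (f15.trans hw) (.const _ _ _))),
        by omega, rfl, rfl, fun r hr => ?_, ?_⟩
      · dsimp only
        rw [Function.update_of_ne (by omega), f_lt r hr]
      · rw [if_neg fun h => h.2.2 hw]
        simpa using f18
    · refine ⟨_, _, hpre _ _ _ (.ite_neg (f16.trans hv) (.ite_pos (f15.trans_ne hw) (.const _ _ _))),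
        by omega, rfl, rfl, fun r hr => ?_, ?_⟩
      · dsimp only
        rw [Function.update_of_ne (by omega), f_lt r hr]
      · rw [if_pos ⟨by omega, by omega, hw⟩]
        simp
  · refine ⟨_, _, hpre _ _ _ (.ite_pos (f16.trans_ne hv) (.const _ _ _)),
        by omega, rfl, rfl, fun r hr => ?_, ?_⟩
    · dsimp only
      rw [Function.update_of_ne (by omega), f_lt r hr]
    · rw [if_neg (by omega)]
      simpa using f18

/-- Mark the pair of vertices given by the slots `k`, `k'` and the positions in the registers
`h₁`, `h₂` and `q₁`, `q₂` with `l + 1` if the former is a hub for the latter in the part `l`; the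
registers `q₁ + 2` and `q₂` give the address of the adjacency of the pair `q₁`, `q₂`. -/
def hubProg (l k k' h₁ h₂ q₁ q₂ : ℕ) : RamProg :=
  if slotEdge l k k' then
    testProg (l + 1) h₁ h₂ (cellPos l (q₁, q₂)).1 (cellPos l (q₁, q₂)).2 (q₁ + 2) q₂
  else .const 15 0

/-- The condition that is tested by `hubProg`. -/
def hubCond (A : ℕ → ℕ → Prop) (l k k' : ℕ) (p q : ℕ × ℕ) : Prop :=
  slotEdge l k k' = true ∧ p = cellPos l q ∧ A q.1 q.2

/-- `cellPos` merely selects components, so applying it to register numbers selects the right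
contents; it and `slotEdge` are evaluated in building the program, not by the machine. -/
theorem marks_hubProg {n : ℕ} {A : ℕ → ℕ → Prop} {l k k' h₁ h₂ q₁ q₂ : ℕ} (s : RamState)
    [Decidable (hubCond A l k k' (s.reg h₁, s.reg h₂) (s.reg q₁, s.reg q₂))]
    (b₁ : h₁ < 15) (b₂ : h₂ < 15) (b₃ : q₁ + 2 < 15) (b₄ : q₂ < 15)
    (hq : s.reg (q₁ + 2) = s.reg q₁ * n)
    (hA : s.mem (1 + s.reg q₁ * n + s.reg q₂) ≠ 0 ↔ A (s.reg q₁) (s.reg q₂)) :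
    Marks (hubProg l k k' h₁ h₂ q₁ q₂) s 14
      (if hubCond A l k k' (s.reg h₁, s.reg h₂) (s.reg q₁, s.reg q₂) then l + 1 else s.reg 18) := by
  unfold hubProg
  by_cases hs : slotEdge l k k' = true
  · rw [if_pos hs]
    convert! marks_testProg s b₁ b₂ (c := l + 1) (p₁ := (cellPos l (q₁, q₂)).1)
      (p₂ := (cellPos l (q₁, q₂)).2) (a₁ := q₁ + 2) (a₂ := q₂) ?_ ?_ b₃ b₄ using 2
    · rw [hq, hA]
      unfold hubCond cellPos
      split_ifs <;> simp [hs, and_assoc]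
    · unfold cellPos
      split_ifs <;> dsimp only <;> omega
    · unfold cellPos
      split_ifs <;> dsimp only <;> omega
  · rw [if_neg hs, if_neg fun h => hs h.1]
    refine ⟨_, _, .const _ _ _, by omega, rfl, rfl, fun r hr => ?_, ?_⟩
    · exact Function.update_of_ne (by omega) _ _
    · simp

/-- The mark of a pair of vertices in the output. -/
noncomputable def markValue (A : ℕ → ℕ → Prop) (k k' : ℕ) (p q : ℕ × ℕ) : ℕ :=
  open Classical in
  if hubCond A 0 k k' p q ∨ hubCond A 0 k' k q p then 1
  else if hubCond A 1 k k' p q ∨ hubCond A 1 k' k q p then 2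
  else if hubCond A 2 k k' p q ∨ hubCond A 2 k' k q p then 3 else 0

/-- Later tests of `markProg` overwrite earlier ones; testing the parts in the order 2, 1, 0
therefore gives part 0 priority, as in `markValue`. -/
theorem ite_or_chain (a a' b b' c c' : Prop) [Decidable a] [Decidable a'] [Decidable b]
    [Decidable b'] [Decidable c] [Decidable c'] [Decidable (a ∨ a')] [Decidable (b ∨ b')]
    [Decidable (c ∨ c')] :
    (if a ∨ a' then 1 else if b ∨ b' then 2 else if c ∨ c' then 3 else 0) =
      if a' then 0 + 1 else if a then 0 + 1 else if b' then 1 + 1 else if b then 1 + 1 else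
        if c' then 2 + 1 else if c then 2 + 1 else 0 := by
  split_ifs <;> first | rfl | tauto

/-- Compute and print the mark of a pair of vertices with positions in the registers `3`, `6` and
`9`, `12`. -/
def markProg (k k' : ℕ) : RamProg :=
  .seq (.seq (.const 18 0) <| .seq (hubProg 2 k k' 3 6 9 12) <| .seq (hubProg 2 k' k 9 12 3 6) <|
    .seq (hubProg 1 k k' 3 6 9 12) <| .seq (hubProg 1 k' k 9 12 3 6) <|
    .seq (hubProg 0 k k' 3 6 9 12) (hubProg 0 k' k 9 12 3 6)) (.print 18)

theorem emits_markProg {n k k' : ℕ} {A : ℕ → ℕ → Prop} (s : RamState)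
    (h5 : s.reg 5 = s.reg 3 * n) (h11 : s.reg 11 = s.reg 9 * n)
    (hA : s.mem (1 + s.reg 3 * n + s.reg 6) ≠ 0 ↔ A (s.reg 3) (s.reg 6))
    (hA' : s.mem (1 + s.reg 9 * n + s.reg 12) ≠ 0 ↔ A (s.reg 9) (s.reg 12)) :
    Emits (markProg k k') 15 s 86
      [markValue A k k' (s.reg 3, s.reg 6) (s.reg 9, s.reg 12)] := by
  classical
  have fwd : ∀ l s', s'.mem = s.mem → (∀ r < 15, s'.reg r = s.reg r) → ∀ x, s'.reg 18 = x →
      Marks (hubProg l k k' 3 6 9 12) s' 14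
        (if hubCond A l k k' (s.reg 3, s.reg 6) (s.reg 9, s.reg 12) then l + 1 else x) := by
    intro l s' hm hr x hx
    have := marks_hubProg (n := n) (A := A) (l := l) (k := k) (k' := k') (h₁ := 3) (h₂ := 6)
      (q₁ := 9) (q₂ := 12) s' (by norm_num) (by norm_num) (by norm_num) (by norm_num)
      (by rw [hr 9 (by norm_num), hr _ (by norm_num)]; exact h11)
      (by rw [hm, hr 9 (by norm_num), hr 12 (by norm_num)]; exact hA')
    simpa only [hr 3 (by norm_num), hr 6 (by norm_num), hr 9 (by norm_num), hr 12 (by norm_num),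
      hx] using this
  have bwd : ∀ l s', s'.mem = s.mem → (∀ r < 15, s'.reg r = s.reg r) → ∀ x, s'.reg 18 = x →
      Marks (hubProg l k' k 9 12 3 6) s' 14
        (if hubCond A l k' k (s.reg 9, s.reg 12) (s.reg 3, s.reg 6) then l + 1 else x) := by
    intro l s' hm hr x hx
    have := marks_hubProg (n := n) (A := A) (l := l) (k := k') (k' := k) (h₁ := 9) (h₂ := 12)
      (q₁ := 3) (q₂ := 6) s' (by norm_num) (by norm_num) (by norm_num) (by norm_num)
      (by rw [hr 3 (by norm_num), hr _ (by norm_num)]; exact h5)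
      (by rw [hm, hr 3 (by norm_num), hr 6 (by norm_num)]; exact hA)
    simpa only [hr 3 (by norm_num), hr 6 (by norm_num), hr 9 (by norm_num), hr 12 (by norm_num),
      hx] using this
  have hzero : Marks (.const 18 0) s 1 0 :=
    ⟨_, _, .const _ _ _, le_rfl, rfl, rfl, fun r hr => Function.update_of_ne (by omega) _ _,
      by simp⟩
  have hall : Marks (.seq (.const 18 0) <| .seq (hubProg 2 k k' 3 6 9 12) <|
      .seq (hubProg 2 k' k 9 12 3 6) <| .seq (hubProg 1 k k' 3 6 9 12) <|
      .seq (hubProg 1 k' k 9 12 3 6) <| .seq (hubProg 0 k k' 3 6 9 12) (hubProg 0 k' k 9 12 3 6))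
      s (1 + (14 + (14 + (14 + (14 + (14 + 14))))))
      (markValue A k k' (s.reg 3, s.reg 6) (s.reg 9, s.reg 12)) := by
    refine hzero.seq fun s₁ m₁ r₁ x₁ => (fwd 2 s₁ m₁ r₁ _ x₁).seq fun s₂ m₂ r₂ x₂ => ?_
    rw [m₁] at m₂
    have r₂' := fun r hr => (r₂ r hr).trans (r₁ r hr)
    refine (bwd 2 s₂ m₂ r₂' _ x₂).seq fun s₃ m₃ r₃ x₃ => ?_
    rw [m₂] at m₃
    have r₃' := fun r hr => (r₃ r hr).trans (r₂' r hr)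
    refine (fwd 1 s₃ m₃ r₃' _ x₃).seq fun s₄ m₄ r₄ x₄ => ?_
    rw [m₃] at m₄
    have r₄' := fun r hr => (r₄ r hr).trans (r₃' r hr)
    refine (bwd 1 s₄ m₄ r₄' _ x₄).seq fun s₅ m₅ r₅ x₅ => ?_
    rw [m₄] at m₅
    have r₅' := fun r hr => (r₅ r hr).trans (r₄' r hr)
    refine (fwd 0 s₅ m₅ r₅' _ x₅).seq fun s₆ m₆ r₆ x₆ => ?_
    rw [m₅] at m₆
    have r₆' := fun r hr => (r₆ r hr).trans (r₅' r hr)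
    convert! bwd 0 s₆ m₆ r₆' _ x₆ using 1
    exact ite_or_chain _ _ _ _ _ _
  obtain ⟨s', t, hrun, ht, hm, ho, hr, hx⟩ := hall
  exact ⟨_, _, .seq hrun (.print 18 s'), by omega, hm, by simp [ho, hx], hr⟩

end Program

/-! ### The constructed graph and its encoding -/

section Construction

/-- The slot tables of the two star parts overlap, but their hubs sit at (u,u) and (v,v) with u ≠ v.
-/
theorem gadgetRel_unique {n : ℕ} (A : SimpleGraph (Fin n)) {l l' : Fin 3} {w w' : Cell n}
    (h : gadgetRel A l w w') (h' : gadgetRel A l' w w') : l = l' := by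
  have key : ∀ (l l' : Fin 3) (k k' : Fin 10), slotEdge l k k' = true → slotEdge l' k k' = true →
      l = l' ∨ (l = 1 ∧ l' = 2) ∨ (l = 2 ∧ l' = 1) := by decide
  have hne : w'.2.1 ≠ w'.2.2 := h.1.ne
  have h3 : cellPos l w'.2 = cellPos l' w'.2 := h.2.2.symm.trans h'.2.2
  rcases key l l' _ _ h.2.1 h'.2.1 with rfl | ⟨rfl, rfl⟩ | ⟨rfl, rfl⟩
  · rfl
  · exact absurd (Prod.mk.inj h3).1 hne
  · exact absurd (Prod.mk.inj h3).1.symm hne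

theorem gadgetRel_swap_unique {n : ℕ} (A : SimpleGraph (Fin n)) {l l' : Fin 3} {w w' : Cell n}
    (h : gadgetRel A l w w') (h' : gadgetRel A l' w' w) : l = l' := by
  have key : ∀ (l l' : Fin 3) (k k' : Fin 10), slotEdge l k k' = true → slotEdge l' k' k = true →
      l = l' := by decide
  exact key l l' _ _ h.2.1 h'.2.1

/-- The numbering of the vertices of the constructed graph. -/
def cellEquiv (n : ℕ) : Fin (10 * (n * n)) ≃ Cell n :=
  finProdFinEquiv.symm.trans (Equiv.prodCongr (Equiv.refl _) finProdFinEquiv.symm)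

/-- The graph of the reduction. -/
def gadgetGraph (G : FiniteGraph) : PartitionedGraph where
  order := 10 * (G.order * G.order)
  graph := ⨆ l, (gadgetPart G.graph l).comap (cellEquiv G.order)
  part l := (gadgetPart G.graph l).comap (cellEquiv G.order)
  edges_eq := SimpleGraph.edgeSet_iSup
  edges_disjoint l l' hl := by
    rw [Set.disjoint_left]
    intro e
    induction e with
    | _ i j =>
      rintro (h | h) (h' | h')
      · exact hl (gadgetRel_unique _ h h')
      · exact hl (gadgetRel_swap_unique _ h h')
      · exact hl (gadgetRel_swap_unique _ h h')
      · exact hl (gadgetRel_unique _ h h')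

theorem gadgetGraph_isDecomposable {G : FiniteGraph} (hG : G.MaxDegreeLE 4) :
    (gadgetGraph G).IsDecomposable (1 / 13) := fun l =>
  ((hasBlockColoring_gadgetPart G.graph hG l).comap
    (cellEquiv G.order).injective).exists_isLambdaSolution (by norm_num) (by norm_num)

/-- Adjacency in terms of natural numbers. -/
def FiniteGraph.natAdj (G : FiniteGraph) (u v : ℕ) : Prop :=
  ∃ (hu : u < G.order) (hv : v < G.order), G.graph.Adj ⟨u, hu⟩ ⟨v, hv⟩

theorem hubCond_natAdj (G : FiniteGraph) (l : Fin 3) (w w' : Cell G.order) :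
    hubCond G.natAdj l w.1 w'.1 (w.2.1, w.2.2) (w'.2.1, w'.2.2) ↔ gadgetRel G.graph l w w' := by
  obtain ⟨k, u, v⟩ := w
  obtain ⟨k', u', v'⟩ := w'
  have h1 : G.natAdj u' v' ↔ G.graph.Adj u' v' :=
    ⟨fun ⟨_, _, h⟩ => h, fun h => ⟨u'.2, v'.2, h⟩⟩
  have h2 : ((u : ℕ), (v : ℕ)) = cellPos l ((u' : ℕ), (v' : ℕ)) ↔ (u, v) = cellPos l (u', v') := by
    unfold cellPos
    split_ifs <;> simp [Fin.ext_iff]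
  simp only [hubCond, gadgetRel, h1, h2]
  tauto

/-! #### Enumerations of products -/

theorem range_mul_flatMap {α : Type} (a b : ℕ) (f : ℕ → List α) :
    (List.range (a * b)).flatMap f =
      (List.range a).flatMap fun x => (List.range b).flatMap fun y => f (x * b + y) := by
  induction a with
  | zero => simp
  | succ a ih =>
    rw [Nat.succ_mul, List.range_add, List.flatMap_append, ih, List.range_succ,
      List.flatMap_append, List.flatMap_singleton, List.flatMap_map]

theorem finRange_flatMap_val {α : Type} (n : ℕ) (f : ℕ → List α) :
    (List.finRange n).flatMap (fun i : Fin n => f i) = (List.range n).flatMap f := by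
  rw [← List.map_coe_finRange_eq_range, List.flatMap_map]

theorem finRange_mul_flatMap {α : Type} (a b : ℕ) (f : Fin a × Fin b → List α) :
    (List.finRange (a * b)).flatMap (fun i => f (finProdFinEquiv.symm i)) =
      (List.finRange a).flatMap fun x => (List.finRange b).flatMap fun y => f (x, y) := by
  rw [List.flatMap_def, ← List.ofFn_eq_map, List.ofFn_mul, List.flatten_flatten, List.map_ofFn,
    List.flatMap_def, ← List.ofFn_eq_map]
  congr 2
  funext x
  rw [Function.comp_apply, List.flatMap_def, ← List.ofFn_eq_map]
  congr 2
  funext y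
  congr 1
  rw [Equiv.symm_apply_eq]
  ext
  simp [finProdFinEquiv, mul_comm, add_comm]

/-- The numbering of the vertices is lexicographic in slot, first and second vertex, which is the
order of the nested loops. -/
theorem finRange_cell_flatMap {α : Type} (n : ℕ) (f : ℕ → ℕ → ℕ → List α) :
    (List.finRange (10 * (n * n))).flatMap (fun i => f (cellEquiv n i).1 (cellEquiv n i).2.1
      (cellEquiv n i).2.2) =
      (List.range 10).flatMap fun k => (List.range n).flatMap fun u =>
        (List.range n).flatMap fun v => f k u v := by
  refine (finRange_mul_flatMap 10 (n * n) fun p => f p.1 (finProdFinEquiv.symm p.2).1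
    (finProdFinEquiv.symm p.2).2).trans ?_
  rw [← finRange_flatMap_val]
  congr 1
  funext k
  refine (finRange_mul_flatMap n n fun p => f k p.1 p.2).trans ?_
  rw [← finRange_flatMap_val]
  congr 1
  funext u
  exact finRange_flatMap_val n (f k u)

theorem encodeMatrix_eq {n : ℕ} {M : Fin n → Fin n → ℕ} {F : ℕ → ℕ → ℕ}
    (h : ∀ i j : Fin n, M i j = F i j) :
    encodeMatrix n M = n :: (List.range (n * n)).map fun x => F (x / n) (x % n) := by
  unfold encodeMatrix
  congr 1
  rw [List.map_eq_flatMap, range_mul_flatMap, ← finRange_flatMap_val]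
  congr 1
  funext i
  rw [List.map_eq_flatMap, ← finRange_flatMap_val]
  congr 1
  funext j
  have hn : 0 < n := i.pos
  rw [h, mul_comm, Nat.mul_add_div hn, Nat.div_eq_of_lt j.2, Nat.mul_add_mod,
    Nat.mod_eq_of_lt j.2, add_zero]

/-- The summand 1 skips the leading entry, the order. -/
theorem encodeMatrix_getD {n : ℕ} {M : Fin n → Fin n → ℕ} (i j : Fin n) :
    (encodeMatrix n M).getD (1 + i * n + j) 0 = M i j := by
  have hn : 0 < n := i.pos
  rw [encodeMatrix_eq (F := fun a b => if h : a < n ∧ b < n then M ⟨a, h.1⟩ ⟨b, h.2⟩ else 0)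
    (by intro i j; simp), add_assoc, add_comm 1, List.getD_cons_succ]
  have hlt : i * n + j < n * n := by
    calc (i : ℕ) * n + j < i * n + n := by omega
      _ = (i + 1) * n := by ring
      _ ≤ n * n := Nat.mul_le_mul_right _ i.2
  rw [List.getD_eq_getElem _ _ (by simpa using hlt)]
  have h1 : ((i : ℕ) * n + j) / n = i := by
    rw [mul_comm, Nat.mul_add_div hn, Nat.div_eq_of_lt j.2, add_zero]
  have h2 : ((i : ℕ) * n + j) % n = j := by
    rw [mul_comm, Nat.mul_add_mod, Nat.mod_eq_of_lt j.2]
  simp [h1, h2]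

/-- The encoding has n² + 1 entries, so a time bound polynomial in n is polynomial in the input
size. -/
theorem le_inputSize_encodeMatrix {n : ℕ} (M : Fin n → Fin n → ℕ) :
    n ≤ inputSize (encodeMatrix n M) := by
  have key : ∀ w : List ℕ, w.length ≤ inputSize w := by
    intro w
    induction w with
    | nil => simp
    | cons x w ih =>
      unfold inputSize at ih ⊢
      rw [List.map_cons, List.sum_cons, List.length_cons]
      omega
  refine le_trans ?_ (key _)
  rw [encodeMatrix_eq (F := fun a b => if h : a < n ∧ b < n then M ⟨a, h.1⟩ ⟨b, h.2⟩ else 0)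
    (by intro i j; simp), List.length_cons, List.length_map, List.length_range]
  nlinarith

theorem encode_gadgetGraph (G : FiniteGraph) :
    (gadgetGraph G).encode = (10 * (G.order * G.order)) ::
      (List.range 10).flatMap fun k => (List.range G.order).flatMap fun u =>
        (List.range G.order).flatMap fun v => (List.range 10).flatMap fun k' =>
          (List.range G.order).flatMap fun u' => (List.range G.order).flatMap fun v' =>
            [markValue G.natAdj k k' (u, v) (u', v')] := by
  classical
  unfold PartitionedGraph.encode encodeMatrix
  refine congrArg₂ List.cons rfl ?_
  rw [← finRange_cell_flatMap G.order]
  refine List.flatMap_congr fun i _ => ?_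
  rw [← finRange_cell_flatMap G.order, List.map_eq_flatMap]
  refine List.flatMap_congr fun j _ => ?_
  congr 1
  unfold markValue
  have h0 := hubCond_natAdj G 0
  have h1 := hubCond_natAdj G 1
  have h2 := hubCond_natAdj G 2
  simp only [Fin.val_zero, Fin.val_one, Fin.val_two] at h0 h1 h2
  simp only [h0, h1, h2]
  exact if_congr Iff.rfl rfl (if_congr Iff.rfl rfl (if_congr Iff.rfl rfl rfl))

end Construction

/-! ### The reduction is computable in polynomial time -/

section PolyTime

/-- Add `reg 4 * reg 1` to register `3`. -/
theorem ramRuns_mulLoop (d : ℕ) (s : RamState) (h4 : s.reg 4 = d) (h2 : s.reg 2 = 1) :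
    RamRuns (.loop 4 (.seq (.add 3 3 1) (.sub 4 4 2))) s
      { s with reg := Function.update (Function.update s.reg 3 (s.reg 3 + d * s.reg 1)) 4 0 }
      (d * 3 + 1) := by
  induction d generalizing s with
  | zero =>
    have e : Function.update (Function.update s.reg 3 (s.reg 3 + 0 * s.reg 1)) 4 0 = s.reg := by
      rw [zero_mul, add_zero, Function.update_eq_self, ← h4, Function.update_eq_self]
    rw [e]
    exact RamRuns.loop_stop h4
  | succ d ih =>
    have := ih { s with reg := Function.update (Function.update s.reg 3 (s.reg 3 + s.reg 1)) 4 d }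
      (by simp) (by simpa using h2)
    have hstep : RamRuns (.seq (.add 3 3 1) (.sub 4 4 2)) s
        { s with reg := Function.update (Function.update s.reg 3 (s.reg 3 + s.reg 1)) 4 d }
        (1 + 1) := by
      refine .seq (.add _ _ _ _) ?_
      convert! RamRuns.sub 4 4 2 _ using 1
      simp [h4, h2]
    convert! RamRuns.loop_step (by omega) hstep this using 1
    · congr 1
      funext r
      by_cases r4 : r = 4
      · simp [r4]
      · by_cases r3 : r = 3
        · subst r3
          simp
          ring
        · simp [r4, r3]
    · ring

/-- Load the order `n` of the input into register `1`, put `1` into register `2` and print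
`10 * (n * n)`. -/
def headProg : RamProg :=
  .seq (.const 1 0) <| .seq (.load 1 1) <| .seq (.const 2 1) <| .seq (.const 3 0) <|
  .seq (.const 4 0) <| .seq (.add 4 4 1) <|
  .seq (.loop 4 (.seq (.add 3 3 1) (.sub 4 4 2))) <|
  .seq (.add 5 3 3) <| .seq (.add 6 5 5) <| .seq (.add 6 6 6) <| .seq (.add 6 6 5) (.print 6)

theorem ramRuns_headProg (s : RamState) {n : ℕ} (hn : s.mem 0 = n) :
    ∃ s' : RamState, RamRuns headProg s s' (n * 3 + 12) ∧ s'.mem = s.mem ∧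
      s'.out = s.out ++ [10 * (n * n)] ∧ s'.reg 1 = n ∧ s'.reg 2 = 1 := by
  have ht : n * 3 + 12 = 1 + (1 + (1 + (1 + (1 + (1 + ((n * 3 + 1) + (1 + (1 + (1 + (1 + 1)))))))))) := by
    omega
  rw [ht]
  refine ⟨_, .seq (.const _ _ _) <| .seq (.load _ _ _) <| .seq (.const _ _ _) <|
    .seq (.const _ _ _) <| .seq (.const _ _ _) <| .seq (.add _ _ _ _) <|
    .seq (ramRuns_mulLoop n _ ?_ ?_) <| .seq (.add _ _ _ _) <| .seq (.add _ _ _ _) <|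
    .seq (.add _ _ _ _) <| .seq (.add _ _ _ _) (.print _ _), ?_, ?_, ?_, ?_⟩
  · simp [hn]
  · simp
  · rfl
  · simp [hn]
    ring
  · simp [hn]
  · simp

/-- Print the marks of all pairs of vertices. -/
def bodyProg : RamProg :=
  unrollProg 3 (fun k => forProg 3 <| forProg 6 <|
    unrollProg 9 (fun k' => forProg 9 <| forProg 12 <| markProg k k') 10) 10

/-- A bound for the number of steps of `bodyProg`. -/
def bodyTime (n : ℕ) : ℕ :=
  10 * (n * ((n * ((10 * (n * ((n * (86 + 4) + 5) + 4) + 5) + 1) + 4) + 5) + 4) + 5) + 1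

/-- Registers 3, 6, 9, 12 hold u, v, u', v', and registers 5, 11 hold un, u'n, so table addresses
need only additions. -/
theorem emits_bodyProg {n : ℕ} {A : ℕ → ℕ → Prop} (s : RamState) (h1 : s.reg 1 = n)
    (h2 : s.reg 2 = 1)
    (hA : ∀ u < n, ∀ v < n, s.mem (1 + u * n + v) ≠ 0 ↔ A u v) :
    Emits bodyProg 3 s (bodyTime n)
      ((List.range 10).flatMap fun k => (List.range n).flatMap fun u =>
        (List.range n).flatMap fun v => (List.range 10).flatMap fun k' =>
          (List.range n).flatMap fun u' => (List.range n).flatMap fun v' =>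
            [markValue A k k' (u, v) (u', v')]) := by
  refine emits_unrollProg fun k _ s₁ m₁ r₁ => ?_
  refine emits_forProg le_rfl (by rw [r₁ 1 (by omega), h1]) (by rw [r₁ 2 (by omega), h2])
    fun u hu s₂ m₂ r₂ e₂ f₂ => ?_
  replace r₂ : ∀ r < 3, s₂.reg r = s.reg r := fun r hr => (r₂ r (by omega)).trans (r₁ r hr)
  refine emits_forProg (by omega) (by rw [r₂ 1 (by omega), h1]) (by rw [r₂ 2 (by omega), h2])
    fun v hv s₃ m₃ r₃ e₃ f₃ => ?_
  refine emits_unrollProg fun k' _ s₄ m₄ r₄ => ?_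
  have q₄ : ∀ r < 3, s₄.reg r = s.reg r := fun r hr =>
    (r₄ r (by omega)).trans ((r₃ r (by omega)).trans (r₂ r hr))
  refine emits_forProg (by omega) (by rw [q₄ 1 (by omega), h1]) (by rw [q₄ 2 (by omega), h2])
    fun u' hu' s₅ m₅ r₅ e₅ f₅ => ?_
  have q₅ : ∀ r < 3, s₅.reg r = s.reg r := fun r hr => (r₅ r (by omega)).trans (q₄ r hr)
  refine emits_forProg (by omega) (by rw [q₅ 1 (by omega), h1]) (by rw [q₅ 2 (by omega), h2])
    fun v' hv' s₆ m₆ r₆ e₆ f₆ => ?_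
  have hu6 : s₆.reg 3 = u := by
    rw [r₆ 3 (by omega), r₅ 3 (by omega), r₄ 3 (by omega), r₃ 3 (by omega), e₂]
  have hU6 : s₆.reg 5 = u * n := by
    rw [r₆ 5 (by omega), r₅ 5 (by omega), r₄ 5 (by omega), r₃ 5 (by omega), f₂]
  have hv6 : s₆.reg 6 = v := by
    rw [r₆ 6 (by omega), r₅ 6 (by omega), r₄ 6 (by omega), e₃]
  have hu6' : s₆.reg 9 = u' := by rw [r₆ 9 (by omega), e₅]
  have hU6' : s₆.reg 11 = u' * n := by rw [r₆ 11 (by omega), f₅]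
  have hmem : s₆.mem = s.mem := by rw [m₆, m₅, m₄, m₃, m₂, m₁]
  have := emits_markProg (n := n) (k := k) (k' := k') (A := A) s₆ (by rw [hU6, hu6])
    (by rw [hU6', hu6']) (by rw [hmem, hu6, hv6]; exact hA u hu v hv)
    (by rw [hmem, hu6', e₆]; exact hA u' hu' v' hv')
  rwa [hu6, hv6, hu6', e₆] at this

open Polynomial in
theorem exists_polynomial_bodyTime :
    ∃ p : ℕ[X], ∀ n N : ℕ, n ≤ N → n * 3 + 12 + bodyTime n ≤ p.eval N := by
  refine ⟨X * 3 + 12 + (10 * (X * ((X * ((10 * (X * ((X * (86 + 4) + 5) + 4) + 5) + 1) + 4) + 5) +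
    4) + 5) + 1), fun n N h => ?_⟩
  simp only [bodyTime, eval_add, eval_mul, eval_X, eval_ofNat, eval_one]
  gcongr

theorem polyTimeComputable_gadgetGraph :
    PolyTimeComputable (fun G' : {G' : FiniteGraph // G'.MaxDegreeLE 4} => G'.1.encode)
      PartitionedGraph.encode fun G' => gadgetGraph G'.1 := by
  classical
  obtain ⟨p, hp⟩ := exists_polynomial_bodyTime
  refine ⟨.seq headProg bodyProg, p, fun G' => ?_⟩
  obtain ⟨G, -⟩ := G'
  dsimp only
  obtain ⟨s₁, r₁, m₁, o₁, e₁, f₁⟩ := ramRuns_headProg (RamState.init G.encode) (n := G.order)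
    (by simp [RamState.init, FiniteGraph.encode, encodeMatrix])
  obtain ⟨s₂, t₂, r₂, ht₂, -, o₂, -⟩ := emits_bodyProg (A := G.natAdj) s₁ e₁ f₁ (by
    intro u hu v hv
    have := encodeMatrix_getD (M := fun i j => if G.graph.Adj i j then 1 else 0) ⟨u, hu⟩ ⟨v, hv⟩
    rw [m₁]
    change G.encode.getD (1 + u * G.order + v) 0 ≠ 0 ↔ _
    unfold FiniteGraph.encode
    rw [this]
    simp [FiniteGraph.natAdj, hu, hv])
  refine ⟨s₂, _, .seq r₁ r₂, le_trans (Nat.add_le_add_left ht₂ _)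
    (hp _ _ (le_inputSize_encodeMatrix _)), ?_⟩
  rw [o₂, o₁, encode_gadgetGraph]
  rfl

end PolyTime

/-! ### Colourings of the constructed graph -/

section Coloring

/-- The colours of a block when the two vertices of its pair have the colours `a` and `b`. -/
def cellColor (k : Fin 10) (a b : Fin 3) : Fin 4 :=
  ![3, 0, 1, 2, a.castSucc, b.castSucc, (-(a + b)).castSucc, 3, 3, a.castSucc] k

/-- Colour 3 is the reference. For distinct `a`, `b` the entry `-(a + b)` modulo 3 is the third
colour, which completes the second K₄. -/
theorem cellColor_ne : ∀ (l : Fin 3) (k k' : Fin 10) (a b : Fin 3), a ≠ b →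
    slotEdge l k k' = true →
      cellColor k (cellPos l (a, b)).1 (cellPos l (a, b)).2 ≠ cellColor k' a b := by
  decide +kernel

theorem cellPos_map {α β : Type} (f : α → β) (l : ℕ) (p : α × α) :
    cellPos l (f p.1, f p.2) = (f (cellPos l p).1, f (cellPos l p).2) := by
  unfold cellPos
  split_ifs <;> rfl

theorem gadgetGraph_adj {G : FiniteGraph} {i j : Fin (gadgetGraph G).order} :
    (gadgetGraph G).graph.Adj i j ↔
      ∃ l, gadgetRel G.graph l (cellEquiv G.order i) (cellEquiv G.order j) ∨
        gadgetRel G.graph l (cellEquiv G.order j) (cellEquiv G.order i) :=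
  SimpleGraph.iSup_adj

theorem gadgetGraph_colorable {G : FiniteGraph} (h : G.graph.Colorable 3) :
    (gadgetGraph G).graph.Colorable 4 := by
  obtain ⟨κ⟩ := h
  let col (w : Cell G.order) : Fin 4 := cellColor w.1 (κ w.2.1) (κ w.2.2)
  have key : ∀ l w w', gadgetRel G.graph l w w' → col w ≠ col w' := by
    rintro l ⟨k, p⟩ ⟨k', q⟩ ⟨h1, h2, h3⟩
    have := cellColor_ne l k k' (κ q.1) (κ q.2) (κ.valid h1) h2
    obtain rfl : p = cellPos l q := h3
    rwa [cellPos_map κ] at this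
  refine ⟨SimpleGraph.Coloring.mk (fun i => col (cellEquiv G.order i)) fun {i j} hij => ?_⟩
  obtain ⟨l, h | h⟩ := gadgetGraph_adj.mp hij
  · exact key l _ _ h
  · exact (key l _ _ h).symm

/-! ### Decoding 4-colourings and counting violated edges -/

/-- The colours different from `z`, renamed. -/
def reduceColor (z x : Fin 4) : Fin 3 := Fin.ofNat 3 ((x + 3 + (4 - z)) % 4)

/-- Before the reduction modulo 3 the value is x - z - 1 modulo 4, which is below 3 exactly when x ≠
z. -/
theorem reduceColor_inj : ∀ z x y : Fin 4, x ≠ z → y ≠ z → reduceColor z x = reduceColor z y →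
    x = y := by decide

/-- A K₄ uses all four colours, so a vertex joined to three of its members must copy the fourth. -/
theorem eq_of_four_colors : ∀ z a b c d : Fin 4, a ≠ b → a ≠ c → a ≠ d → b ≠ c → b ≠ d → c ≠ d →
    z ≠ b → z ≠ c → z ≠ d → z = a := by decide +kernel

theorem exists_violated {n : ℕ} (φ : Cell n → Fin 4) (u v : Fin n)
    (h : reduceColor (φ (8, u, u)) (φ (9, u, u)) = reduceColor (φ (8, v, v)) (φ (9, v, v))) :
    ∃ (l : Fin 3) (k k' : Fin 10), slotEdge l k k' = true ∧
      φ (k, cellPos l (u, v)) = φ (k', u, v) := by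
  by_contra! hne
  have h0 : ∀ k k' : Fin 10, slotEdge 0 k k' = true → φ (k, u, v) ≠ φ (k', u, v) := hne 0
  have h1 : ∀ k k' : Fin 10, slotEdge 1 k k' = true → φ (k, u, u) ≠ φ (k', u, v) := hne 1
  have h2 : ∀ k k' : Fin 10, slotEdge 2 k k' = true → φ (k, v, v) ≠ φ (k', u, v) := hne 2
  have clique : ∀ (z : Fin 4) (a b c d : Fin 10), slotEdge 0 a b = true → slotEdge 0 a c = true →
      slotEdge 0 a d = true → slotEdge 0 b c = true → slotEdge 0 b d = true →
      slotEdge 0 c d = true → z ≠ φ (b, u, v) → z ≠ φ (c, u, v) → z ≠ φ (d, u, v) →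
      z = φ (a, u, v) := fun z a b c d e1 e2 e3 e4 e5 e6 =>
    eq_of_four_colors z _ _ _ _ (h0 _ _ e1) (h0 _ _ e2) (h0 _ _ e3) (h0 _ _ e4) (h0 _ _ e5)
      (h0 _ _ e6)
  have zu := clique (φ (8, u, u)) 0 1 2 3 rfl rfl rfl rfl rfl rfl (h1 8 1 rfl) (h1 8 2 rfl)
    (h1 8 3 rfl)
  have zv := clique (φ (8, v, v)) 0 1 2 3 rfl rfl rfl rfl rfl rfl (h2 8 1 rfl) (h2 8 2 rfl)
    (h2 8 3 rfl)
  have xu := clique (φ (9, u, u)) 4 5 6 7 rfl rfl rfl rfl rfl rfl (h1 9 5 rfl) (h1 9 6 rfl)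
    (h1 9 7 rfl)
  have xv := clique (φ (9, v, v)) 5 4 6 7 rfl rfl rfl rfl rfl rfl (h2 9 4 rfl) (h2 9 6 rfl)
    (h2 9 7 rfl)
  -- The edges from the colour hubs to slot 0 keep their colours off the reference colour, as
  -- `reduceColor_inj` requires.
  have nu := h1 9 0 rfl
  have nv := h2 9 0 rfl
  rw [xu] at nu
  rw [xv] at nv
  rw [zu, zv, xu, xv] at h
  exact h0 4 5 rfl (reduceColor_inj _ _ _ nu nv h)

theorem gadgetRel_swap {n : ℕ} {A : SimpleGraph (Fin n)} {l l' : Fin 3} {w w' : Cell n}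
    (h : gadgetRel A l w w') (h' : gadgetRel A l' w' w) : w.2 = w'.2 := by
  have key : ∀ (l l' : Fin 3) (k k' : Fin 10), slotEdge l k k' = true → slotEdge l' k' k = true →
      l = 0 := by decide
  obtain rfl := key l l' _ _ h.2.1 h'.2.1
  exact h.2.2

/-- An edge determines the block that owns it, so violated edges found in different blocks are
different. -/
theorem gadgetRel_block_unique {n : ℕ} {A : SimpleGraph (Fin n)} {l l' : Fin 3} {a b a' b' : Cell n}
    (h : gadgetRel A l a b) (h' : gadgetRel A l' a' b') (he : s(a, b) = s(a', b')) :
    b.2 = b'.2 := by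
  rcases Sym2.eq_iff.mp he with ⟨rfl, rfl⟩ | ⟨rfl, rfl⟩
  · rfl
  · exact (gadgetRel_swap h h').symm

theorem exists_violatedEdges_le (G : FiniteGraph) (χ : Fin (gadgetGraph G).order → Fin 4) :
    ∃ χ' : Fin G.order → Fin 3,
      (violatedEdges G.graph χ').ncard ≤ (violatedEdges (gadgetGraph G).graph χ).ncard := by
  classical
  let e : Fin (gadgetGraph G).order ≃ Cell G.order := cellEquiv G.order
  let φ (w : Cell G.order) : Fin 4 := χ (e.symm w)
  let χ' (u : Fin G.order) : Fin 3 := reduceColor (φ (8, u, u)) (φ (9, u, u))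
  refine ⟨χ', ?_⟩
  have key : ∀ d ∈ violatedEdges G.graph χ', ∃ (l : Fin 3) (a b : Cell G.order),
      gadgetRel G.graph l a b ∧ s(b.2.1, b.2.2) = d ∧ φ a = φ b := by
    intro d
    induction d with
    | _ u v =>
      rintro ⟨h1, h2⟩
      obtain ⟨l, k, k', hs, hφ⟩ := exists_violated φ u v h2
      exact ⟨l, (k, cellPos l (u, v)), (k', u, v), ⟨h1, hs, rfl⟩, rfl, hφ⟩
  rcases (violatedEdges G.graph χ').eq_empty_or_nonempty with hempty | ⟨d₀, hd₀⟩
  · rw [hempty, Set.ncard_empty]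
    exact Nat.zero_le _
  -- The choice functions below need default values outside the violated edges.
  have : Nonempty (Cell G.order) := (key d₀ hd₀).elim fun _ h => ⟨h.choose⟩
  choose! l a b hrel hd hφ using key
  refine Set.ncard_le_ncard_of_injOn (fun d => s(e.symm (a d), e.symm (b d))) ?_ ?_ (Set.toFinite _)
  · intro d hd'
    refine ⟨gadgetGraph_adj.mpr ⟨l d, Or.inl ?_⟩, hφ d hd'⟩
    change gadgetRel G.graph (l d) (e (e.symm (a d))) (e (e.symm (b d)))
    simpa using hrel d hd'
  · intro d hd' d' hd'' heq
    have h1 : s(a d, b d) = s(a d', b d') := by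
      have := congrArg (Sym2.map e) heq
      simpa using this
    have h2 := gadgetRel_block_unique (hrel d hd') (hrel d' hd'') h1
    rw [← hd d hd', ← hd d' hd'', h2]

/-- An orientation of an edge of `G`, a part and two slots determine any edge: 600 = 2 · 3 · 10 ·
10. -/
theorem ncard_edgeSet_gadgetGraph_le (G : FiniteGraph) :
    (gadgetGraph G).graph.edgeSet.ncard ≤ 600 * G.graph.edgeSet.ncard := by
  classical
  let e : Fin (gadgetGraph G).order ≃ Cell G.order := cellEquiv G.order
  let f (x : G.graph.Dart × Fin 3 × Fin 10 × Fin 10) : Sym2 (Fin (gadgetGraph G).order) :=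
    s(e.symm (x.2.2.1, cellPos x.2.1 x.1.toProd), e.symm (x.2.2.2, x.1.toProd))
  have hsub : (gadgetGraph G).graph.edgeSet ⊆ f '' Set.univ := by
    have key : ∀ (l : Fin 3) (i j : Fin (gadgetGraph G).order),
        gadgetRel G.graph l (e i) (e j) → s(i, j) ∈ f '' Set.univ := by
      intro l i j h
      refine ⟨(⟨(e j).2, h.1⟩, l, (e i).1, (e j).1), trivial, ?_⟩
      have h1 : ((e i).1, cellPos l (e j).2) = e i := by rw [← h.2.2]
      simp only [f, h1]
      exact congrArg₂ (fun x y => s(x, y)) (e.symm_apply_apply i) (e.symm_apply_apply j)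
    intro d
    induction d with
    | _ i j =>
      intro hij
      obtain ⟨l, h | h⟩ := gadgetGraph_adj.mp hij
      · exact key l i j h
      · rw [Sym2.eq_swap]
        exact key l j i h
  calc (gadgetGraph G).graph.edgeSet.ncard ≤ (f '' Set.univ).ncard :=
        Set.ncard_le_ncard hsub (Set.toFinite _)
    _ ≤ (Set.univ : Set (G.graph.Dart × Fin 3 × Fin 10 × Fin 10)).ncard :=
        Set.ncard_image_le (Set.toFinite _)
    _ = 600 * G.graph.edgeSet.ncard := by
        rw [Set.ncard_univ, Nat.card_eq_fintype_card, Fintype.card_prod,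
          SimpleGraph.dart_card_eq_twice_card_edges, ← SimpleGraph.coe_edgeFinset,
          Set.ncard_coe_finset]
        simp only [Fintype.card_prod, Fintype.card_fin]
        ring

theorem fractionUncolorable_gadgetGraph {G : FiniteGraph} {ξ : ℝ}
    (h : FractionUncolorable 3 G.graph ξ) :
    FractionUncolorable 4 (gadgetGraph G).graph (1 / 600 * ξ) := by
  intro χ
  obtain ⟨χ', hle⟩ := exists_violatedEdges_le G χ
  have h1 : ((violatedEdges G.graph χ').ncard : ℝ) ≤
      (violatedEdges (gadgetGraph G).graph χ).ncard := by exact_mod_cast hle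
  have h2 : ((gadgetGraph G).graph.edgeSet.ncard : ℝ) ≤ 600 * G.graph.edgeSet.ncard := by
    exact_mod_cast ncard_edgeSet_gadgetGraph_le G
  have h3 : ((violatedEdges (gadgetGraph G).graph χ).ncard : ℝ) ≤
      (gadgetGraph G).graph.edgeSet.ncard := by
    exact_mod_cast Set.ncard_le_ncard (Set.sep_subset _ _) (Set.toFinite _)
  have hξ := h χ'
  generalize ((violatedEdges G.graph χ').ncard : ℝ) = x' at *
  generalize hx : ((violatedEdges (gadgetGraph G).graph χ).ncard : ℝ) = x at *
  generalize hm : ((gadgetGraph G).graph.edgeSet.ncard : ℝ) = m at *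
  generalize hm' : (G.graph.edgeSet.ncard : ℝ) = m' at *
  have hx0 : 0 ≤ x := hx ▸ Nat.cast_nonneg _
  have hm0 : 0 ≤ m' := hm' ▸ Nat.cast_nonneg _
  calc 1 / 600 * ξ ≤ 1 / 600 * (x / m') := by
        gcongr
        exact hξ.trans (by gcongr)
    _ = x / (600 * m') := by
        rw [div_mul_div_comm, one_mul]
    _ ≤ x / m := by
        -- For m = 0 both quotients vanish, because x ≤ m.
        rcases (hx0.trans h3).eq_or_lt with hz | hz
        · have : x = 0 := le_antisymm (hz ▸ h3) hx0
          simp [this]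
        · exact div_le_div_of_nonneg_left hx0 hz h2

end Coloring

theorem mainTheorem7 :
    ∃ lam : ℝ, 0 < lam ∧ lam < 1 / 4 ∧ ∃ c : ℝ, 0 < c ∧
      ∃ f : {G' : FiniteGraph // G'.MaxDegreeLE 4} → PartitionedGraph,
        PolyTimeComputable (fun G' => G'.1.encode) PartitionedGraph.encode f ∧
        ∀ G' : {G' : FiniteGraph // G'.MaxDegreeLE 4},
          (f G').IsDecomposable lam ∧
          (G'.1.graph.Colorable 3 → (f G').graph.Colorable 4) ∧
          ∀ ξ' : ℝ, FractionUncolorable 3 G'.1.graph ξ' →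
            FractionUncolorable 4 (f G').graph (c * ξ') :=
  ⟨1 / 13, by norm_num, by norm_num, 1 / 600, by norm_num, fun G' => gadgetGraph G'.1,
    polyTimeComputable_gadgetGraph, fun G' => ⟨gadgetGraph_isDecomposable G'.2,
      gadgetGraph_colorable, fun _ => fractionUncolorable_gadgetGraph⟩⟩
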